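/- All graphs are finite and simple. A $4$-path vertex cover of $G=(V,E)$ is a set $F\subseteq V$ such that $G[V\setminus F]$ contains no simple path on four vertices (as a subgraph, not necessarily induced); $\psi_4(G)$ is the minimum size of such a set, and P4VC is the problem of finding one. A defective $(2,1)$-coloring of $G$ colors $V$ with two colors so that each vertex has at most one neighbor of its own color. The triangle graph $\mathcal G$ of $G$ has the triangles ($3$-cycles) of $G$ as its vertices, two distinct triangles being adjacent if and only if they share an edge or are joined by an edge of $G$. MIS is the maximum independent set problem, and $\alpha$ denotes the independence number. A set $I$ that an MIS algorithm returns on a graph $H$ is a $\rho$-approximation if $I$ is independent and $\alpha(H)\le\rho|I|$. Algorithm Approx1, on a cubic graph $G=(V,E)$: (1) compute a defective $(2,1)$-coloring of $G$; (2) let $F^{\min}$ be its smaller color class, that is, the complement of the larger one; (3) construct the triangle graph $\mathcal G$; (4) run an MIS approximation algorithm $A$ for graphs of maximum degree at most $3$ on $\mathcal G$ to obtain an independent set $I$, and let $F$ be the set of all vertices of $G$ that lie on no triangle of $I$; (5) return the smaller of $F^{\min}$ and $F$. Ties are broken arbitrarily. Theorem. Algorithm Approx1, with a $\frac65$-approximation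 as its MIS subroutine, is a $\frac{15}8$-approximation for P4VC on cubic graphs. More generally, for every real $\varepsilon\ge 0$, a subroutine of ratio $\frac65+\varepsilon$ makes Approx1 a $\left(\frac{15}8+\varepsilon\right)$-approximation. Precisely: (a) Let $G$ be a cubic graph and $\varepsilon\ge0$. Whatever defective $(2,1)$-coloring of $G$ is computed, and whatever independent set $I$ of $\mathcal G$ with $\alpha(\mathcal G)\le\left(\frac65+\varepsilon\right)|I|$ is obtained, the set that Approx1 returns is a $4$-path vertex cover of $G$ of size at most $\left(\frac{15}8+\varepsilon\right)\psi_4(G)$. (b) On a random access machine with unit-cost addition, subtraction and comparison, there are a program $P$ with subroutine calls and a polynomial $p$ such that the following holds for every program $A$. If $A$ halts with an independent set on every graph of maximum degree at most $3$, then $P$ with subroutine $A$ implements Approx1 with MIS subroutine $A$: on every cubic graph $G$ with $n$ vertices it halts with an output of Approx1, after at most $p(n)$ steps plus the number of steps of one run of $A$ on $\mathcal G$. If $A$ is a polynomial-time $\left(\frac65+\varepsilon\right)$-approximation algorithm for MIS on graphs of maximum degree at most $3$, for some $\varepsilon\ge0$, then $P$ with subroutine $A$ is a polynomial-time $\left(\frac{15}8+\varepsilon\right)$-approximation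 algorithm for P4VC on cubic graphs. -/

import Mathlib

/-! ### Path vertex covers, defective colorings, triangle graphs -/

/-- `F` is a `k`-path vertex cover of `G`: the subgraph induced on the complement of `F` contains no
simple path with `k` vertices (as a not necessarily induced subgraph). -/
def IsPathVertexCover {V : Type*} (G : SimpleGraph V) (k : ℕ) (F : Finset V) : Prop :=
  (SimpleGraph.pathGraph k).Free (G.induce {v | v ∉ F})

/-- `ψ_k(G)`, the minimum cardinality of a `k`-path vertex cover of `G`. -/
noncomputable def pathVertexCoverNum {V : Type*} (G : SimpleGraph V) (k : ℕ) : ℕ :=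
  sInf {m | ∃ F : Finset V, IsPathVertexCover G k F ∧ F.card = m}

/-- A defective `(p, q)`-coloring: every vertex has at most `q` neighbors of its own color. -/
def IsDefectiveColoring {V : Type*} (G : SimpleGraph V) (p q : ℕ) (c : V → Fin p) : Prop :=
  ∀ v, {w | G.Adj v w ∧ c w = c v}.encard ≤ q

/-- The triangles (`3`-cycles) of `G`, given by their vertex sets. -/
def Triangle {V : Type*} (G : SimpleGraph V) : Type _ := {t : Finset V // G.IsNClique 3 t}

/-- The triangle graph: two distinct triangles are adjacent if they share an edge or are joined by
an edge of `G`. -/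
def triangleGraph {V : Type*} (G : SimpleGraph V) : SimpleGraph (Triangle G) where
  Adj t s := t ≠ s ∧
    ((∃ u v, u ≠ v ∧ u ∈ t.1 ∧ v ∈ t.1 ∧ u ∈ s.1 ∧ v ∈ s.1) ∨
      (∃ u ∈ t.1, ∃ v ∈ s.1, G.Adj u v))
  symm := ⟨by
    rintro t s ⟨hne, h | ⟨u, hu, v, hv, h⟩⟩
    · obtain ⟨u, v, huv, h1, h2, h3, h4⟩ := h
      exact ⟨hne.symm, Or.inl ⟨u, v, huv, h3, h4, h1, h2⟩⟩
    · exact ⟨hne.symm, Or.inr ⟨v, hv, u, hu, h.symm⟩⟩⟩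
  loopless := ⟨fun _ h => h.1 rfl⟩

/-- `F` is a possible output of the algorithm Approx1 on `G` when the coloring it computes is `c`
and the independent set it obtains in the triangle graph is `I` (ties are broken arbitrarily):
`Fmin` is the smaller color class of `c`, that is, the complement of the larger class `Fmax`, `FI` is
the set of all vertices not on the triangles of `I`, and `F` is the smaller one of the two. -/
def IsApprox1Output {V : Type*} (G : SimpleGraph V) (c : V → Fin 2)
    (I : Finset (Triangle G)) (F : Finset V) : Prop :=
  ∃ (i : Fin 2) (Fmin Fmax FI : Finset V),
    (∀ v, v ∈ Fmin ↔ c v = i) ∧ (∀ v, v ∈ Fmax ↔ c v ≠ i) ∧ Fmin.card ≤ Fmax.card ∧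
    (∀ v, v ∈ FI ↔ ∀ t ∈ I, v ∉ t.1) ∧
    ((F = Fmin ∧ Fmin.card ≤ FI.card) ∨ (F = FI ∧ FI.card ≤ Fmin.card))

/-! ### A machine model: while-programs on a random access machine

Registers and (two-dimensional) array cells hold natural numbers. Reading, writing, comparing,
adding and (truncated) subtracting cost one step each; there is no multiplication. All registers and
arrays that are not part of the input are initially `0`. A program may call a subroutine. -/

/-- The contents of an array. -/
abbrev Arr : Type := ℕ → ℕ → ℕ

/-- A machine state: registers and arrays. -/
structure MState where
  reg : ℕ → ℕ
  arr : ℕ → Arr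

/-- Expressions. -/
inductive Expr : Type
  | const (k : ℕ)
  | var (x : ℕ)
  | get (a : ℕ) (i j : Expr)
  | add (e f : Expr)
  | sub (e f : Expr)
  | lt (e f : Expr)
  | eq (e f : Expr)

/-- The value of an expression (`1` for true, `0` for false). -/
def Expr.eval (s : MState) : Expr → ℕ
  | .const k => k
  | .var x => s.reg x
  | .get a i j => s.arr a (i.eval s) (j.eval s)
  | .add e f => e.eval s + f.eval s
  | .sub e f => e.eval s - f.eval s
  | .lt e f => if e.eval s < f.eval s then 1 else 0
  | .eq e f => if e.eval s = f.eval s then 1 else 0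

/-- The number of steps needed to evaluate an expression: one for each of its nodes. -/
def Expr.cost : Expr → ℕ
  | .const _ => 1
  | .var _ => 1
  | .get _ i j => i.cost + j.cost + 1
  | .add e f => e.cost + f.cost + 1
  | .sub e f => e.cost + f.cost + 1
  | .lt e f => e.cost + f.cost + 1
  | .eq e f => e.cost + f.cost + 1

/-- Programs. `call m a b` calls the subroutine with the number `m` and the array `a` as its input,
and stores the array that it returns as array `b`. -/
inductive Prog : Type
  | skip
  | assign (x : ℕ) (e : Expr)
  | put (a : ℕ) (i j e : Expr)
  | seq (p q : Prog)
  | ite (e : Expr) (p q : Prog)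
  | loop (e : Expr) (p : Prog)
  | call (m : Expr) (a b : ℕ)

/-- The behavior of a subroutine: `O m H out t` says that on input `(m, H)` it halts after `t` steps
and returns the array `out`. -/
abbrev Subroutine : Type := ℕ → Arr → Arr → ℕ → Prop

/-- `Exec O p s s' t`: started in state `s`, the program `p` with subroutine `O` halts in state `s'`
after exactly `t` steps (those of the subroutine included). -/
inductive Exec (O : Subroutine) : Prog → MState → MState → ℕ → Prop
  | skip (s : MState) : Exec O .skip s s 1
  | assign (x : ℕ) (e : Expr) (s : MState) :
      Exec O (.assign x e) s ⟨Function.update s.reg x (e.eval s), s.arr⟩ (e.cost + 1)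
  | put (a : ℕ) (i j e : Expr) (s : MState) :
      Exec O (.put a i j e) s
        ⟨s.reg, Function.update s.arr a (Function.update (s.arr a) (i.eval s)
          (Function.update (s.arr a (i.eval s)) (j.eval s) (e.eval s)))⟩
        (i.cost + j.cost + e.cost + 1)
  | seq {p q : Prog} {s s₁ s₂ : MState} {t₁ t₂ : ℕ} (h₁ : Exec O p s s₁ t₁)
      (h₂ : Exec O q s₁ s₂ t₂) : Exec O (.seq p q) s s₂ (t₁ + t₂)
  | iteTrue {e : Expr} {p q : Prog} {s s₁ : MState} {t : ℕ} (he : e.eval s ≠ 0)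
      (h : Exec O p s s₁ t) : Exec O (.ite e p q) s s₁ (e.cost + 1 + t)
  | iteFalse {e : Expr} {p q : Prog} {s s₁ : MState} {t : ℕ} (he : e.eval s = 0)
      (h : Exec O q s s₁ t) : Exec O (.ite e p q) s s₁ (e.cost + 1 + t)
  | loopTrue {e : Expr} {p : Prog} {s s₁ s₂ : MState} {t₁ t₂ : ℕ} (he : e.eval s ≠ 0)
      (h₁ : Exec O p s s₁ t₁) (h₂ : Exec O (.loop e p) s₁ s₂ t₂) :
      Exec O (.loop e p) s s₂ (e.cost + 1 + t₁ + t₂)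
  | loopFalse {e : Expr} {p : Prog} {s : MState} (he : e.eval s = 0) :
      Exec O (.loop e p) s s (e.cost + 1)
  | call (m : Expr) (a b : ℕ) {s : MState} {out : Arr} {t : ℕ}
      (h : O (m.eval s) (s.arr a) out t) :
      Exec O (.call m a b) s ⟨s.reg, Function.update s.arr b out⟩ (m.cost + 1 + t)

/-- The initial state on input `(m, H)`: `m` in register `0` and `H` in array `0`. -/
def initState (m : ℕ) (H : Arr) : MState :=
  ⟨Function.update (fun _ => 0) 0 m, Function.update (fun _ _ _ => 0) 0 H⟩

/-- No subroutine: a `call` never succeeds. -/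
def noSub : Subroutine := fun _ _ _ _ => False

/-- The program `A` (which itself has no subroutine), used as a subroutine. It runs in a fresh state
and returns its array `1`. -/
def Prog.asSub (A : Prog) : Subroutine := fun m H out t =>
  ∃ s', Exec noSub A (initState m H) s' t ∧ s'.arr 1 = out

open Classical in
/-- The adjacency matrix of a graph on `{0, …, n - 1}`, with `0` outside of the `n × n` square. -/
noncomputable def adjArr {n : ℕ} (G : SimpleGraph (Fin n)) : Arr := fun i j =>
  if ∃ (hi : i < n) (hj : j < n), G.Adj ⟨i, hi⟩ ⟨j, hj⟩ then 1 else 0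

/-- On the input graph `G` the program `P` with subroutine `O` halts after exactly `t` steps and
outputs the vertex set `S`, namely those `v` whose entry `(v, 0)` in array `1` is nonzero. -/
def RunsOn (O : Subroutine) (P : Prog) {n : ℕ} (G : SimpleGraph (Fin n)) (S : Finset (Fin n))
    (t : ℕ) : Prop :=
  ∃ s', Exec O P (initState n (adjArr G)) s' t ∧ ∀ v : Fin n, v ∈ S ↔ s'.arr 1 v 0 ≠ 0

/-- On every graph of maximum degree at most `3`, the program `A` halts and outputs an independent
set. -/
def FindsIndepSets (A : Prog) : Prop :=
  ∀ (m : ℕ) (H : SimpleGraph (Fin m)) [H.LocallyFinite], (∀ v, H.degree v ≤ 3) →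
    ∃ (I : Finset (Fin m)) (t : ℕ), RunsOn noSub A H I t ∧ H.IsIndepSet (I : Set (Fin m))

/-- `A` is a polynomial-time `ρ`-approximation algorithm for the maximum independent set problem on
graphs of maximum degree at most `3`. -/
def IsMISApproximation (ρ : ℝ) (A : Prog) : Prop :=
  ∃ q : Polynomial ℕ, ∀ (m : ℕ) (H : SimpleGraph (Fin m)) [H.LocallyFinite],
    (∀ v, H.degree v ≤ 3) →
      ∃ (I : Finset (Fin m)) (t : ℕ), RunsOn noSub A H I t ∧ t ≤ q.eval m ∧
        H.IsIndepSet (I : Set (Fin m)) ∧ (H.indepNum : ℝ) ≤ ρ * (I.card : ℝ)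

/-- `P`, with subroutine `O`, is a polynomial-time `ρ`-approximation algorithm for the minimum
`4`-path vertex cover problem on cubic graphs. -/
def IsP4VCApproximation (ρ : ℝ) (O : Subroutine) (P : Prog) : Prop :=
  ∃ p : Polynomial ℕ, ∀ (n : ℕ) (G : SimpleGraph (Fin n)) [G.LocallyFinite],
    G.IsRegularOfDegree 3 →
      ∃ (F : Finset (Fin n)) (t : ℕ), RunsOn O P G F t ∧ t ≤ p.eval n ∧
        IsPathVertexCover G 4 F ∧ (F.card : ℝ) ≤ ρ * (pathVertexCoverNum G 4 : ℝ)

/-- The program `P` implements the algorithm Approx1 with the program `A` as its subroutine for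
independent sets, and spends at most `p n` steps outside of `A`: on every cubic graph `G` with
vertices `0, …, n - 1` it outputs a set that Approx1 may return for some defective
`(2, 1)`-coloring `c` of `G` and for the independent set that `A` finds in the triangle graph,
the triangles being numbered in some way `e`. -/
def ImplementsApprox1 (P A : Prog) (p : Polynomial ℕ) : Prop :=
  ∀ (n : ℕ) (G : SimpleGraph (Fin n)) [G.LocallyFinite], G.IsRegularOfDegree 3 →
    ∃ (c : Fin n → Fin 2) (m : ℕ) (e : Fin m ≃ Triangle G) (J : Finset (Fin m)) (tA : ℕ)
      (F : Finset (Fin n)) (t : ℕ),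
      IsDefectiveColoring G 2 1 c ∧
      RunsOn noSub A ((triangleGraph G).comap e) J tA ∧
      IsApprox1Output G c (J.map e.toEmbedding) F ∧
      RunsOn A.asSub P G F t ∧ t ≤ p.eval n + tA

/-! ### Path vertex covers of cubic graphs and triangles -/

/-! Ratio. Let `F₀` be a minimum cover of a cubic graph on `n` vertices. What is left outside `F₀`
has no path on four vertices, so its components are triangles and stars with at most three leaves. A
star has average degree at most 3/2, a triangle 2. Counting the edges between `F₀` and the rest from
both sides gives `n ≤ 3ψ + τ`, where `τ` is the number of triangle components; each of these sends
three edges into `F₀`, so also `4τ ≤ n` (`card_bounds_of_isPathVertexCover`). These triangles are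
independent in the triangle graph, hence `τ ≤ α ≤ (6/5 + ε)|I|`. The output has at most `n/2`
vertices because of the coloring and at most `n - 3|I|` because of the triangles of `I`, which are
disjoint. A weighted mean of the two bounds yields the ratio (`approx_ratio_bound`).

Both candidates are covers: vertices of one color induce maximum degree 1, and the triangles of an
independent `I` are whole components of what they cover.

Algorithm. The subroutine applies because the triangle graph has maximum degree at most 3
(`card_adj_triangleGraph_le`): a vertex of a triangle has one edge leaving it, and outside a `K₄`
this edge leads to at most one other triangle. The coloring is found by local search: flipping a
vertex with two neighbors of its own color removes monochromatic edges. The remaining work is a few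
nested loops, verified with the time-bounded triples `Ends`; `exists_run_approx1Prog` joins them.
Arrays hold the graph (0), the output (1), the colors (2), the triangles (3), the triangle graph
(4), the subroutine's answer (5) and the vertices off its triangles (6). -/

theorem isPathVertexCover_four_iff {V : Type*} (G : SimpleGraph V) (F : Finset V) :
    IsPathVertexCover G 4 F ↔ ∀ a b c d, a ∉ F → b ∉ F → c ∉ F → d ∉ F → a ≠ c → a ≠ d → b ≠ d →
      G.Adj a b → G.Adj b c → G.Adj c d → False := by
  constructor
  · intro h a b c d ha hb hc hd hac had hbd hab hbc hcd
    refine h ⟨⟨⟨![⟨a, ha⟩, ⟨b, hb⟩, ⟨c, hc⟩, ⟨d, hd⟩], ?_⟩, ?_⟩⟩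
    · intro i j hij
      rw [SimpleGraph.pathGraph_adj] at hij
      fin_cases i <;> fin_cases j <;> simp_all [SimpleGraph.adj_comm]
    · intro i j hij
      -- Consecutive vertices differ because they are adjacent; only the other three inequalities
      -- are assumed.
      have := hab.ne
      have := hbc.ne
      have := hcd.ne
      fin_cases i <;> fin_cases j <;> simp_all
  · rintro h ⟨f⟩
    have inj : ∀ i j : Fin 4, i ≠ j → (f i).1 ≠ (f j).1 := fun i j hij e =>
      hij (f.injective (Subtype.ext e))
    have adj : ∀ i j : Fin 4, (i : ℕ) + 1 = j → G.Adj (f i).1 (f j).1 := fun i j hij =>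
      f.toHom.map_adj (SimpleGraph.pathGraph_adj.2 (Or.inl hij))
    exact h _ _ _ _ (f 0).2 (f 1).2 (f 2).2 (f 3).2 (inj 0 2 (by decide)) (inj 0 3 (by decide))
      (inj 1 3 (by decide)) (adj 0 1 rfl) (adj 1 2 rfl) (adj 2 3 rfl)

instance {V : Type*} [Finite V] (G : SimpleGraph V) : Finite (Triangle G) :=
  inferInstanceAs (Finite {t : Finset V // G.IsNClique 3 t})

theorem Triangle.ext {V : Type*} {G : SimpleGraph V} {s t : Triangle G} (h : s.1 = t.1) : s = t :=
  Subtype.ext h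

theorem Triangle.card_eq {V : Type*} {G : SimpleGraph V} (t : Triangle G) : t.1.card = 3 :=
  t.2.card_eq

theorem Triangle.adj {V : Type*} {G : SimpleGraph V} (t : Triangle G) {u v : V} (hu : u ∈ t.1)
    (hv : v ∈ t.1) (h : u ≠ v) : G.Adj u v :=
  t.2.isClique hu hv h

theorem Triangle.exists_ne_ne {V : Type*} {G : SimpleGraph V} (t : Triangle G) (u v : V) :
    ∃ w ∈ t.1, w ≠ u ∧ w ≠ v := by
  classical
  by_contra! h
  have : t.1 ⊆ {u, v} := fun w hw => by
    by_cases e : w = u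
    · simp [e]
    · simp [h w hw e]
  have := Finset.card_le_card this
  have := Finset.card_le_two (a := u) (b := v)
  have := t.card_eq
  omega

theorem Triangle.eq_or_eq_or_eq {V : Type*} {G : SimpleGraph V} (t : Triangle G) {a b c x : V}
    (ha : a ∈ t.1) (hb : b ∈ t.1) (hc : c ∈ t.1) (hab : a ≠ b) (hac : a ≠ c) (hbc : b ≠ c)
    (hx : x ∈ t.1) : x = a ∨ x = b ∨ x = c := by
  classical
  have h : ({a, b, c} : Finset V) = t.1 := by
    apply Finset.eq_of_subset_of_card_le
    · simp [Finset.insert_subset_iff, *]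
    · rw [t.card_eq, Finset.card_eq_three.2 ⟨a, b, c, hab, hac, hbc, rfl⟩]
  rw [← h] at hx
  simpa using hx

/-- Sharing an edge is subsumed by being joined by an edge. -/
theorem triangleGraph_adj_iff {V : Type*} (G : SimpleGraph V) (t s : Triangle G) :
    (triangleGraph G).Adj t s ↔ t ≠ s ∧ ∃ u ∈ t.1, ∃ v ∈ s.1, G.Adj u v := by
  constructor
  · rintro ⟨h, ⟨u, v, huv, hu, hv, hu', hv'⟩ | h'⟩
    · exact ⟨h, u, hu, v, hv', t.adj hu hv huv⟩
    · exact ⟨h, h'⟩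
  · rintro ⟨h, h'⟩
    exact ⟨h, Or.inr h'⟩

theorem triangleGraph_adj_of_mem_mem {V : Type*} {G : SimpleGraph V} {t s : Triangle G} {v : V}
    (h : t ≠ s) (ht : v ∈ t.1) (hs : v ∈ s.1) : (triangleGraph G).Adj t s := by
  obtain ⟨u, hu, huv, -⟩ := t.exists_ne_ne v v
  exact (triangleGraph_adj_iff G t s).2 ⟨h, u, hu, v, hs, t.adj hu ht huv⟩

theorem disjoint_of_isIndepSet_triangleGraph {V : Type*} {G : SimpleGraph V}
    {I : Set (Triangle G)} (hI : (triangleGraph G).IsIndepSet I) {t s : Triangle G} (ht : t ∈ I)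
    (hs : s ∈ I) (h : t ≠ s) : Disjoint t.1 s.1 :=
  Finset.disjoint_left.2 fun _ hv hv' =>
    hI ht hs h (triangleGraph_adj_of_mem_mem h hv hv')

theorem card_biUnion_of_isIndepSet_triangleGraph {V : Type*} [DecidableEq V] {G : SimpleGraph V}
    {I : Finset (Triangle G)} (hI : (triangleGraph G).IsIndepSet (I : Set (Triangle G))) :
    (I.biUnion (fun t => t.1)).card = 3 * I.card := by
  rw [Finset.card_biUnion fun t ht s hs h => disjoint_of_isIndepSet_triangleGraph hI ht hs h,
    Finset.sum_congr rfl fun t _ => t.card_eq]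
  simp [mul_comm]

/-- The triangles that avoid a `4`-path vertex cover are independent in the triangle graph. -/
theorem isIndepSet_triangleGraph_of_isPathVertexCover {V : Type*} {G : SimpleGraph V}
    {F : Finset V} (hF : IsPathVertexCover G 4 F) :
    (triangleGraph G).IsIndepSet {t | ∀ v ∈ t.1, v ∉ F} := by
  rw [isPathVertexCover_four_iff] at hF
  intro t ht s hs hne hadj
  obtain ⟨-, u, hu, v, hv, huv⟩ := (triangleGraph_adj_iff G t s).1 hadj
  -- If `v` were outside `t = {u, x, y}`, then `v u x y` would be a path avoiding `F`.
  have key : ∀ (t s : Triangle G), (∀ v ∈ t.1, v ∉ F) → (∀ v ∈ s.1, v ∉ F) →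
      ∀ u ∈ t.1, ∀ v ∈ s.1, G.Adj u v → v ∈ t.1 := by
    intro t s ht hs u hu v hv huv
    by_contra hvt
    obtain ⟨x, hx, hxu, -⟩ := t.exists_ne_ne u u
    obtain ⟨y, hy, hyu, hyx⟩ := t.exists_ne_ne u x
    refine hF v u x y (hs v hv) (ht u hu) (ht x hx) (ht y hy) ?_ ?_ hyu.symm huv.symm
      (t.adj hu hx hxu.symm) (t.adj hx hy hyx.symm)
    · rintro rfl; exact hvt hx
    · rintro rfl; exact hvt hy
  have hvt := key t s ht hs u hu v hv huv
  have : s.1 ⊆ t.1 := by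
    intro w hw
    by_cases e : w = v
    · exact e ▸ hvt
    · exact key t s ht hs v hvt w hw (s.adj hv hw (Ne.symm e))
  exact hne (Triangle.ext (Finset.eq_of_subset_of_card_le this
    (by rw [t.card_eq, s.card_eq])).symm)

/-! ### Edge counting for the lower bound on ψ₄ -/

section Counting

variable {V : Type*} [Fintype V] [DecidableEq V] (G : SimpleGraph V) [DecidableRel G.Adj]

/-- Double counting of the edges between `F` and its complement: the left side counts them from
outside, and each vertex of `F` meets at most three. -/
theorem sum_card_adj_compl_le (hG : ∀ v, (Finset.univ.filter (G.Adj v)).card = 3) (F : Finset V) :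
    ∑ v ∈ Fᶜ, (3 - (Fᶜ.filter (G.Adj v)).card) ≤ 3 * F.card := by
  have h1 : ∀ v ∈ Fᶜ, 3 - (Fᶜ.filter (G.Adj v)).card = (F.filter (G.Adj v)).card := by
    intro v _
    have := Finset.card_union_of_disjoint (Finset.disjoint_filter_filter (p := G.Adj v)
      (q := G.Adj v) (disjoint_compl_right (a := F)))
    rw [← Finset.filter_union, Finset.union_compl, hG v] at this
    omega
  rw [Finset.sum_congr rfl h1]
  have h2 := Finset.sum_card_bipartiteAbove_eq_sum_card_bipartiteBelow (s := Fᶜ) (t := F) G.Adj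
  unfold Finset.bipartiteAbove Finset.bipartiteBelow at h2
  rw [h2, mul_comm, ← smul_eq_mul]
  refine Finset.sum_le_card_nsmul _ _ _ fun f _ => ?_
  rw [← hG f]
  apply Finset.card_le_card
  intro v hv
  simpa [G.adj_comm] using (Finset.mem_filter.1 hv).2

/-- The counting argument behind the lower bound on `ψ₄`: in a `P₄`-free part of a cubic graph
the average degree is at most `3 / 2`, apart from the triangles. -/
theorem card_bounds_of_isPathVertexCover (hG : ∀ v, (Finset.univ.filter (G.Adj v)).card = 3)
    {F : Finset V} (hF : IsPathVertexCover G 4 F) {I : Finset (Triangle G)}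
    (hI : ∀ t, t ∈ I ↔ ∀ v ∈ t.1, v ∉ F) :
    Fintype.card V ≤ 3 * F.card + I.card ∧ 4 * I.card ≤ Fintype.card V := by
  have hind := isIndepSet_triangleGraph_of_isPathVertexCover hF
  have hIset : (I : Set (Triangle G)) = {t | ∀ v ∈ t.1, v ∉ F} := by ext t; simp [hI]
  rw [← hIset] at hind
  have hTcard := card_biUnion_of_isIndepSet_triangleGraph hind
  have hsum := sum_card_adj_compl_le G hG F
  have hcompl := Finset.card_compl_add_card F
  rw [isPathVertexCover_four_iff] at hF
  set S := Fᶜ with hS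
  set T := I.biUnion (fun t => t.1) with hT
  set N : V → Finset V := fun v => S.filter (G.Adj v) with hN
  have memS : ∀ v, v ∈ S ↔ v ∉ F := fun v => by simp [hS]
  have memN : ∀ v w, w ∈ N v ↔ w ∉ F ∧ G.Adj v w := fun v w => by simp [hN, memS]
  have hTS : T ⊆ S := by
    intro v hv
    obtain ⟨t, ht, hvt⟩ := Finset.mem_biUnion.1 hv
    exact (memS v).2 ((hI t).1 ht v hvt)
  have memT : ∀ u v w, u ∉ F → v ∉ F → w ∉ F → G.Adj u v → G.Adj v w → G.Adj u w → u ∈ T := by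
    intro u v w hu hv hw huv hvw huw
    refine Finset.mem_biUnion.2 ⟨⟨{u, v, w}, SimpleGraph.is3Clique_triple_iff.2 ⟨huv, huw, hvw⟩⟩,
      (hI _).2 ?_, by simp⟩
    intro x hx
    simp only [Finset.mem_insert, Finset.mem_singleton] at hx
    rcases hx with rfl | rfl | rfl <;> assumption
  have hNle : ∀ v, (N v).card ≤ 3 := fun v =>
    (hG v) ▸ Finset.card_le_card (Finset.filter_subset_filter _ (Finset.subset_univ _))
  -- A third neighbor `z` of `v` outside `F` would give the path `z v x y`.
  have hNT : ∀ v ∈ T, (N v).card = 2 := by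
    intro v hv
    obtain ⟨t, ht, hvt⟩ := Finset.mem_biUnion.1 hv
    obtain ⟨x, hx, hxv, -⟩ := t.exists_ne_ne v v
    obtain ⟨y, hy, hyv, hyx⟩ := t.exists_ne_ne v x
    have hF' := (hI t).1 ht
    have : N v = {x, y} := by
      ext z
      rw [memN]
      simp only [Finset.mem_insert, Finset.mem_singleton]
      constructor
      · rintro ⟨hz, hvz⟩
        by_contra! hzz
        exact hF z v x y hz (hF' v hvt) (hF' x hx) (hF' y hy) hzz.1 hzz.2 hyv.symm hvz.symm
          (t.adj hvt hx hxv.symm) (t.adj hx hy hyx.symm)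
      · rintro (rfl | rfl)
        · exact ⟨hF' _ hx, t.adj hvt hx hxv.symm⟩
        · exact ⟨hF' _ hy, t.adj hvt hy hyv.symm⟩
    rw [this, Finset.card_pair hyx.symm]
  -- `A` consists of the centers of the stars with at least two leaves; `B` consists of all vertices
  -- of degree 1, including both ends of an isolated edge.
  set A := S.filter (fun v => v ∉ T ∧ 2 ≤ (N v).card) with hA
  set B := S.filter (fun v => v ∉ T ∧ (N v).card = 1) with hB
  -- Let `x ≠ w` be another neighbor of the center `v`. A neighbor `z ≠ v` of `w` closes a triangle
  -- at `v` if `z = x`, and gives the path `x v w z` otherwise.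
  have hAN : ∀ v ∈ A, ∀ w ∈ N v, N w = {v} := by
    intro v hv w hw
    obtain ⟨hvS, hvT, hv2⟩ := Finset.mem_filter.1 hv
    obtain ⟨hwF, hvw⟩ := (memN v w).1 hw
    have hvF := (memS v).1 hvS
    obtain ⟨x, hx, hxw⟩ := Finset.exists_mem_ne (by omega : 1 < (N v).card) w
    obtain ⟨hxF, hvx⟩ := (memN v x).1 hx
    ext z
    rw [memN, Finset.mem_singleton]
    constructor
    · rintro ⟨hzF, hwz⟩
      by_contra hzv
      by_cases hxz : x = z
      · subst hxz
        exact hvT (memT v w x hvF hwF hxF hvw hwz hvx)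
      · exact hF x v w z hxF hvF hwF hzF hxw hxz (Ne.symm hzv) hvx.symm hvw hwz
    · rintro rfl
      exact ⟨hvF, hvw.symm⟩
  have hAB : ∑ v ∈ A, (N v).card ≤ B.card := by
    rw [← Finset.card_biUnion]
    · apply Finset.card_le_card
      intro w hw
      obtain ⟨v, hv, hwv⟩ := Finset.mem_biUnion.1 hw
      have h1 : (N w).card = 1 := by rw [hAN v hv w hwv, Finset.card_singleton]
      refine Finset.mem_filter.2 ⟨(memS w).2 ((memN v w).1 hwv).1, fun hwT => ?_, h1⟩
      have := hNT w hwT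
      omega
    · intro u hu v hv huv
      refine Finset.disjoint_left.2 fun w hwu hwv => huv ?_
      have := hAN u hu w hwu
      rw [hAN v hv w hwv] at this
      simpa using this.symm
  -- Discharging: a center of degree `d` receives `d`, paid by its `d` leaves with one unit each. By
  -- `hAB` these terms cancel after summation, which leaves twice the degree sum at most `3|S| +
  -- |T|`.
  have hpt : ∀ v ∈ S, 2 * (N v).card + (if v ∉ T ∧ (N v).card = 1 then 1 else 0) ≤
      3 + (if v ∈ T then 1 else 0) + (if v ∉ T ∧ 2 ≤ (N v).card then (N v).card else 0) := by
    intro v _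
    have := hNle v
    have := hNT v
    by_cases hvT : v ∈ T
    · simp [hvT, this hvT]
    · simp only [hvT, not_false_eq_true, true_and, if_false]
      split_ifs <;> omega
  have hpt' := Finset.sum_le_sum hpt
  simp only [Finset.sum_add_distrib, ← Finset.mul_sum, ← Finset.sum_filter, Finset.sum_const,
    smul_eq_mul, mul_one] at hpt'
  rw [← hA, ← hB, Finset.filter_mem_eq_inter, Finset.inter_eq_right.2 hTS] at hpt'
  have hsum' : 3 * S.card ≤ 3 * F.card + ∑ v ∈ S, (N v).card := by
    have : ∑ v ∈ S, 3 = ∑ v ∈ S, ((3 - (N v).card) + (N v).card) :=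
      Finset.sum_congr rfl fun v _ => by have := hNle v; omega
    rw [Finset.sum_add_distrib, Finset.sum_const, smul_eq_mul] at this
    have hs : ∑ v ∈ S, (3 - (N v).card) ≤ 3 * F.card := hsum
    omega
  -- Each vertex of a triangle sends exactly one edge into `F`, whence `|I| ≤ |F|` and the second
  -- bound.
  have hT3 : T.card ≤ ∑ v ∈ S, (3 - (N v).card) := by
    calc T.card = ∑ v ∈ T, (3 - (N v).card) := by
          rw [Finset.card_eq_sum_ones]
          exact Finset.sum_congr rfl fun v hv => by rw [hNT v hv]
      _ ≤ _ := Finset.sum_le_sum_of_subset hTS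
  have hs : ∑ v ∈ S, (3 - (N v).card) ≤ 3 * F.card := hsum
  have := Finset.card_le_card hTS
  omega

end Counting

/-! ### Correctness and approximation ratio of Approx1 -/

theorem exists_isPathVertexCover_card_eq {V : Type*} [Fintype V] (G : SimpleGraph V) (k : ℕ)
    (hk : k ≠ 0) : ∃ F : Finset V, IsPathVertexCover G k F ∧ F.card = pathVertexCoverNum G k := by
  refine Nat.sInf_mem (s := {m | ∃ F : Finset V, IsPathVertexCover G k F ∧ F.card = m})
    ⟨_, Finset.univ, ?_, rfl⟩
  rintro ⟨f⟩
  exact (f ⟨0, Nat.pos_of_ne_zero hk⟩).2 (Finset.mem_univ _)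

/-- The inner vertex `b` of a path in the other color class would have two neighbors of its own
color, so even three vertices are impossible. -/
theorem isPathVertexCover_of_colorClass {V : Type*} {G : SimpleGraph V} {c : V → Fin 2}
    (hc : IsDefectiveColoring G 2 1 c) {i : Fin 2} {F : Finset V} (hF : ∀ v, v ∈ F ↔ c v = i) :
    IsPathVertexCover G 4 F := by
  rw [isPathVertexCover_four_iff]
  intro a b x d ha hb hx _ hax _ _ hab hbx _
  rw [hF] at ha hb hx
  have h := hc b
  have : c a = c b := by omega
  have : c x = c b := by omega
  rw [Nat.cast_one, Set.encard_le_one_iff] at h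
  exact hax (h a x ⟨hab.symm, ‹_›⟩ ⟨hbx, ‹_›⟩)

/-- No edge joins two triangles of `I`, so a path off `F` stays in one triangle, which has only
three vertices. -/
theorem isPathVertexCover_of_isIndepSet_triangleGraph {V : Type*} {G : SimpleGraph V}
    {I : Finset (Triangle G)} (hI : (triangleGraph G).IsIndepSet (I : Set (Triangle G)))
    {F : Finset V} (hF : ∀ v, v ∈ F ↔ ∀ t ∈ I, v ∉ t.1) : IsPathVertexCover G 4 F := by
  classical
  rw [isPathVertexCover_four_iff]
  intro a b c d ha hb hc hd hac had hbd hab hbc hcd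
  have key : ∀ t ∈ I, ∀ u v, u ∈ t.1 → v ∉ F → G.Adj u v → v ∈ t.1 := by
    intro t ht u v hu hv huv
    simp only [hF, not_forall, not_not] at hv
    obtain ⟨s, hs, hvs⟩ := hv
    by_cases e : t = s
    · exact e ▸ hvs
    · exact (hI ht hs e ((triangleGraph_adj_iff G t s).2 ⟨e, u, hu, v, hvs, huv⟩)).elim
  have ha' := ha
  simp only [hF, not_forall, not_not] at ha'
  obtain ⟨t, ht, hat⟩ := ha'
  have hbt := key t ht a b hat hb hab
  have hct := key t ht b c hbt hc hbc
  have hdt := key t ht c d hct hd hcd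
  have := t.eq_or_eq_or_eq hat hbt hct hab.ne hac hbc.ne hdt
  have := hcd.ne
  grind

/-- For `ε ≥ 1/8` the factor is at least 2, and `3f ≤ 3n/2 ≤ 2(n - τ)` suffices. Otherwise `h1` and
`h2` are mixed with weights `1 - μ` and `μ`, where `μ` makes the multiple of `i` match the bound on
`τ`. For `ε = 0` this gives `μ = 1/4`, and `3/2 + 3μ/2` is exactly 15/8. -/
theorem approx_ratio_bound {n f τ i : ℕ} {ε ψ : ℝ} (hε : 0 ≤ ε) (hψ : (n : ℝ) ≤ 3 * ψ + τ)
    (hτ : 4 * τ ≤ n) (hi : (τ : ℝ) ≤ (6 / 5 + ε) * i) (h1 : 2 * f ≤ n) (h2 : f + 3 * i ≤ n) :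
    (f : ℝ) ≤ (15 / 8 + ε) * ψ := by
  have hτ' : (4 : ℝ) * τ ≤ n := by exact_mod_cast hτ
  have h1' : (2 : ℝ) * f ≤ n := by exact_mod_cast h1
  have h2' : (f : ℝ) + 3 * i ≤ n := by exact_mod_cast h2
  have hf : (0 : ℝ) ≤ f := Nat.cast_nonneg f
  have hτ0 : (0 : ℝ) ≤ τ := Nat.cast_nonneg τ
  have hn0 : (0 : ℝ) ≤ n := Nat.cast_nonneg n
  have hi0 : (0 : ℝ) ≤ i := Nat.cast_nonneg i
  suffices h : 3 * (f : ℝ) ≤ (15 / 8 + ε) * (n - τ) by nlinarith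
  rcases le_total (1 / 8) ε with h8 | h8
  · nlinarith
  · obtain ⟨μ, hμ⟩ : ∃ μ : ℝ, μ = (6 / 5 + ε) * (15 / 8 + ε) / 9 := ⟨_, rfl⟩
    have hμ0 : 0 ≤ μ := by rw [hμ]; positivity
    have hμ1 : μ ≤ 1 := by rw [hμ]; nlinarith
    have e1 : (1 - μ) * (2 * f) ≤ (1 - μ) * n := mul_le_mul_of_nonneg_left h1' (by linarith)
    have e2 : μ * (f + 3 * i) ≤ μ * n := mul_le_mul_of_nonneg_left h2' hμ0
    have e3 : (15 / 8 + ε) * τ ≤ 9 * μ * i := by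
      calc (15 / 8 + ε) * τ ≤ (15 / 8 + ε) * ((6 / 5 + ε) * i) :=
            mul_le_mul_of_nonneg_left hi (by linarith)
        _ = 9 * μ * i := by rw [hμ]; ring
    have e4 : (3 / 2 + 3 / 2 * μ) * n ≤ (15 / 8 + ε) * n :=
      mul_le_mul_of_nonneg_right (by rw [hμ]; nlinarith) hn0
    nlinarith

theorem isPathVertexCover_and_card_le_of_isApprox1Output {V : Type*} [Fintype V] (G : SimpleGraph V) [G.LocallyFinite]
    (hG : G.IsRegularOfDegree 3) (ε : ℝ) (hε : 0 ≤ ε) (c : V → Fin 2)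
    (hc : IsDefectiveColoring G 2 1 c) (I : Finset (Triangle G))
    (hI : (triangleGraph G).IsIndepSet (I : Set (Triangle G)))
    (hα : ((triangleGraph G).indepNum : ℝ) ≤ (6 / 5 + ε) * (I.card : ℝ)) (F : Finset V)
    (hF : IsApprox1Output G c I F) :
    IsPathVertexCover G 4 F ∧ (F.card : ℝ) ≤ (15 / 8 + ε) * (pathVertexCoverNum G 4 : ℝ) := by
  classical
  obtain ⟨i, Fmin, Fmax, FI, hmin, hmax, hle, hFI, hF⟩ := hF
  constructor
  · rcases hF with ⟨rfl, -⟩ | ⟨rfl, -⟩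
    · exact isPathVertexCover_of_colorClass hc hmin
    · exact isPathVertexCover_of_isIndepSet_triangleGraph hI hFI
  have hG' : ∀ v, (Finset.univ.filter (G.Adj v)).card = 3 := by
    intro v
    rw [← hG v, ← SimpleGraph.card_neighborFinset_eq_degree]
    congr 1
    ext w
    simp
  obtain ⟨F₀, hF₀, hψ⟩ := exists_isPathVertexCover_card_eq G 4 (by decide)
  let _ : Fintype (Triangle G) := Fintype.ofFinite _
  set J : Finset (Triangle G) := Finset.univ.filter (fun t => ∀ v ∈ t.1, v ∉ F₀) with hJ
  obtain ⟨b1, b2⟩ := card_bounds_of_isPathVertexCover G hG' hF₀ (I := J) (by simp [hJ])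
  have hJα : J.card ≤ (triangleGraph G).indepNum := by
    apply SimpleGraph.IsIndepSet.card_le_indepNum
    have := isIndepSet_triangleGraph_of_isPathVertexCover hF₀
    simpa [hJ] using this
  have hmm : Fmin.card + Fmax.card = Fintype.card V := by
    have : Fmax = Fminᶜ := by ext v; simp [hmin, hmax]
    rw [this, Finset.card_add_card_compl]
  have hII : FI.card + 3 * I.card = Fintype.card V := by
    have : FI = (I.biUnion (fun t => t.1))ᶜ := by ext v; simp [hFI]
    rw [this, ← card_biUnion_of_isIndepSet_triangleGraph hI, Finset.card_compl_add_card]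
  refine approx_ratio_bound (n := Fintype.card V) (τ := J.card) (i := I.card) hε ?_ b2
    (le_trans (by exact_mod_cast hJα) hα) ?_ ?_
  · rw [← hψ]; exact_mod_cast b1
  · rcases hF with ⟨rfl, h⟩ | ⟨rfl, h⟩ <;> omega
  · rcases hF with ⟨rfl, h⟩ | ⟨rfl, h⟩ <;> omega

/-! ### The maximum degree of the triangle graph -/

theorem Triangle.exists_others {V : Type*} [DecidableEq V] {G : SimpleGraph V} (t : Triangle G) {u : V} (hu : u ∈ t.1) :
    ∃ a b, t.1 = {u, a, b} ∧ u ≠ a ∧ u ≠ b ∧ a ≠ b := by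
  obtain ⟨a, ha, hau, -⟩ := t.exists_ne_ne u u
  obtain ⟨b, hb, hbu, hba⟩ := t.exists_ne_ne u a
  refine ⟨a, b, ?_, hau.symm, hbu.symm, hba.symm⟩
  symm
  apply Finset.eq_of_subset_of_card_le
  · simp [Finset.insert_subset_iff, *]
  · rw [t.card_eq, Finset.card_eq_three.2 ⟨u, a, b, hau.symm, hbu.symm, hba.symm, rfl⟩]

/-- If the joining edge ends inside `t`, its end `v` is common to both triangles, and an edge of `s`
from `v` to a vertex off `t` serves instead. -/
theorem Triangle.exists_adj_outside {V : Type*} {G : SimpleGraph V} {t s : Triangle G} (h : (triangleGraph G).Adj t s) :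
    ∃ u ∈ t.1, ∃ w ∈ s.1, w ∉ t.1 ∧ G.Adj u w := by
  obtain ⟨hne, u, hu, v, hv, huv⟩ := (triangleGraph_adj_iff G t s).1 h
  by_cases hvt : v ∈ t.1
  · have : ¬ s.1 ⊆ t.1 := fun hsub => hne (Triangle.ext
      (Finset.eq_of_subset_of_card_le hsub (by rw [t.card_eq, s.card_eq])).symm)
    obtain ⟨w, hw, hwt⟩ := Finset.not_subset.1 this
    exact ⟨v, hvt, w, hw, hwt, s.adj hv hw (by rintro rfl; exact hwt hvt)⟩
  · exact ⟨u, hu, v, hv, hvt, huv⟩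

section Degree

variable {V : Type*} [Fintype V] [DecidableEq V] (G : SimpleGraph V) [DecidableRel G.Adj]

theorem adj_mem_of_three (hG : ∀ v, (Finset.univ.filter (G.Adj v)).card = 3) {v a b c x : V}
    (ha : G.Adj v a) (hb : G.Adj v b) (hc : G.Adj v c) (hab : a ≠ b) (hac : a ≠ c) (hbc : b ≠ c)
    (hx : G.Adj v x) : x = a ∨ x = b ∨ x = c := by
  have h : ({a, b, c} : Finset V) = Finset.univ.filter (G.Adj v) := by
    apply Finset.eq_of_subset_of_card_le
    · simp [Finset.insert_subset_iff, *]
    · rw [hG, Finset.card_eq_three.2 ⟨a, b, c, hab, hac, hbc, rfl⟩]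
  have : x ∈ ({a, b, c} : Finset V) := by rw [h]; simpa using hx
  simpa using this

/-- In a cubic graph, a vertex `w` that is joined to a triangle lies on at most one triangle,
unless it is adjacent to all vertices of the triangle. -/
theorem Triangle.adj_of_two (hG : ∀ v, (Finset.univ.filter (G.Adj v)).card = 3)
    {t s s' : Triangle G} {u w : V} (hu : u ∈ t.1) (hw : w ∉ t.1) (huw : G.Adj u w)
    (hs : w ∈ s.1) (hs' : w ∈ s'.1) (hne : s ≠ s') : ∀ x ∈ t.1, G.Adj x w := by
  obtain ⟨p, q, hpq, hwp, hwq, hpq'⟩ := s.exists_others hs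
  obtain ⟨p', q', hpq2, hwp', hwq', hpq2'⟩ := s'.exists_others hs'
  obtain ⟨x, y, hxy, hux, huy, hxy'⟩ := t.exists_others hu
  have hne' : s.1 ≠ s'.1 := fun h => hne (Triangle.ext h)
  have a1 : G.Adj w p := s.adj hs (by simp [hpq]) hwp
  have a2 : G.Adj w q := s.adj hs (by simp [hpq]) hwq
  have a3 : G.Adj p q := s.adj (by simp [hpq]) (by simp [hpq]) hpq'
  have b1 : G.Adj w p' := s'.adj hs' (by simp [hpq2]) hwp'
  have b2 : G.Adj w q' := s'.adj hs' (by simp [hpq2]) hwq'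
  have b3 : G.Adj p' q' := s'.adj (by simp [hpq2]) (by simp [hpq2]) hpq2'
  have c1 : G.Adj u x := t.adj hu (by simp [hxy]) hux
  have c2 : G.Adj u y := t.adj hu (by simp [hxy]) huy
  have c3 : G.Adj x y := t.adj (by simp [hxy]) (by simp [hxy]) hxy'
  have hwx : w ≠ x := by rintro rfl; simp [hxy] at hw
  have hwy : w ≠ y := by rintro rfl; simp [hxy] at hw
  have hN := @adj_mem_of_three V _ _ G _ hG
  have hNu := fun z => @hN u x y w z c1 c2 huw hxy' hwx.symm hwy.symm
  suffices h : G.Adj x w ∧ G.Adj y w by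
    intro z hz
    simp only [hxy, Finset.mem_insert, Finset.mem_singleton] at hz
    rcases hz with rfl | rfl | rfl
    exacts [huw, h.1, h.2]
  -- the two triangles share an edge at `w`
  obtain ⟨p, q, r, a1, a2, a4, a3, a5, hpq', hpr', hqr'⟩ : ∃ p q r, G.Adj w p ∧ G.Adj w q ∧
      G.Adj w r ∧ G.Adj p q ∧ G.Adj p r ∧ p ≠ q ∧ p ≠ r ∧ q ≠ r := by
    by_cases h1 : p' = p
    · subst h1
      exact ⟨p', q, q', a1, a2, b2, a3, b3, hpq', hpq2', by rintro rfl; exact hne' (by rw [hpq, hpq2])⟩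
    by_cases h2 : p' = q
    · subst h2
      exact ⟨p', p, q', a2, a1, b2, a3.symm, b3, hpq'.symm, hpq2',
        by rintro rfl; exact hne' (by rw [hpq, hpq2, Finset.pair_comm])⟩
    rcases @hN w p q p' q' a1 a2 b1 hpq' (Ne.symm h1) (Ne.symm h2) b2 with rfl | rfl | rfl
    · exact ⟨q', q, p', a1, a2, b1, a3, b3.symm, hpq', Ne.symm h1, Ne.symm h2⟩
    · exact ⟨q', p, p', a2, a1, b1, a3.symm, b3.symm, hpq'.symm, Ne.symm h2, Ne.symm h1⟩
    · exact (hpq2' rfl).elim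
  have hNp := fun z => @hN p w q r z a1.symm a3 a5 a2.ne a4.ne hqr'
  -- The neighbors of `p` are `w, q, r`, those of `u` are `x, y, w`. If `u = p`, then `q, r` are `x,
  -- y`. If `u` is `q` or `r`, then `p` is one of `x, y`, and the other one, a neighbor of `p`, is
  -- the remaining one of `q, r`.
  rcases @hN w p q r u a1 a2 a4 hpq' hpr' hqr' huw.symm with rfl | rfl | rfl
  · rcases hNu q a3 with rfl | rfl | rfl
    · rcases hNu r a5 with rfl | rfl | rfl
      · exact (hqr' rfl).elim
      · exact ⟨a2.symm, a4.symm⟩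
      · exact (a4.ne rfl).elim
    · rcases hNu r a5 with rfl | rfl | rfl
      · exact ⟨a4.symm, a2.symm⟩
      · exact (hqr' rfl).elim
      · exact (a4.ne rfl).elim
    · exact (a2.ne rfl).elim
  · have h1 := hNu p a3.symm
    have := a1.ne
    rcases h1 with rfl | rfl | rfl
    · rcases hNp y c3 with rfl | rfl | rfl
      · exact (hwy rfl).elim
      · exact (huy rfl).elim
      · exact ⟨a1.symm, a4.symm⟩
    · rcases hNp x c3.symm with rfl | rfl | rfl
      · exact (hwx rfl).elim
      · exact (hux rfl).elim
      · exact ⟨a4.symm, a1.symm⟩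
    · exact (this rfl).elim
  · have h1 := hNu p a5.symm
    have := a1.ne
    rcases h1 with rfl | rfl | rfl
    · rcases hNp y c3 with rfl | rfl | rfl
      · exact (hwy rfl).elim
      · exact ⟨a1.symm, a2.symm⟩
      · exact (huy rfl).elim
    · rcases hNp x c3.symm with rfl | rfl | rfl
      · exact (hwx rfl).elim
      · exact ⟨a2.symm, a1.symm⟩
      · exact (hux rfl).elim
    · exact (this rfl).elim

/-- The triangle graph of a cubic graph has maximum degree at most `3`. -/
theorem card_adj_triangleGraph_le (hG : ∀ v, (Finset.univ.filter (G.Adj v)).card = 3)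
    (t : Triangle G) (N : Finset (Triangle G)) (hN : ∀ s ∈ N, (triangleGraph G).Adj t s) :
    N.card ≤ 3 := by
  classical
  have hout : ∀ u ∈ t.1, ∀ w w', w ∉ t.1 → w' ∉ t.1 → G.Adj u w → G.Adj u w' → w' = w := by
    intro u hu w w' hw hw' h h'
    obtain ⟨x, y, hxy, hux, huy, hxy'⟩ := t.exists_others hu
    have c1 : G.Adj u x := t.adj hu (by simp [hxy]) hux
    have c2 : G.Adj u y := t.adj hu (by simp [hxy]) huy
    simp only [hxy, Finset.mem_insert, Finset.mem_singleton, not_or] at hw hw'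
    have := adj_mem_of_three G hG c1 c2 h hxy' (Ne.symm hw.2.1) (Ne.symm hw.2.2) h'
    tauto
  have hNt : ∀ s ∈ N, s ≠ t := fun s hs => ((hN s hs).ne).symm
  obtain ⟨z₀, -⟩ := t.1.card_pos.1 (by rw [t.card_eq]; norm_num)
  have : Nonempty V := ⟨z₀⟩
  choose! u hu w hws hwt huw using fun s hs => Triangle.exists_adj_outside (hN s hs)
  -- If such a `w` exists, `t` and `w` form a `K₄` component, which contains three other triangles.
  -- If not, sending `s` to the vertex `u s` of `t` with an edge to `s` is injective: equal values
  -- force equal ends `w s`, and `Triangle.adj_of_two` would yield a `K₄`.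
  by_cases hK : ∃ w, w ∉ t.1 ∧ ∀ x ∈ t.1, G.Adj x w
  · obtain ⟨z, hz, hadj⟩ := hK
    have hsub : ∀ s ∈ N, s.1 ∈ ((insert z t.1).powersetCard 3).erase t.1 := by
      intro s hs
      refine Finset.mem_erase.2 ⟨fun e => hNt s hs (Triangle.ext e),
        Finset.mem_powersetCard.2 ⟨?_, s.card_eq⟩⟩
      have hwz : w s = z :=
        hout _ (hu s hs) z (w s) hz (hwt s hs) (hadj _ (hu s hs)) (huw s hs)
      have hzs : z ∈ s.1 := hwz ▸ hws s hs
      obtain ⟨x, y, hxy, hux, huy, hxy'⟩ := t.exists_others (hu s hs)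
      intro v hv
      by_cases e : z = v
      · simp [e]
      · have := adj_mem_of_three G hG (hadj _ (hu s hs)).symm (hadj x (by simp [hxy])).symm
          (hadj y (by simp [hxy])).symm hux huy hxy' (s.adj hzs hv e)
        simp [hxy, this]
    calc N.card ≤ (((insert z t.1).powersetCard 3).erase t.1).card :=
          Finset.card_le_card_of_injOn (fun s => s.1) hsub fun s _ s' _ h => Triangle.ext h
      _ = 3 := by
          rw [Finset.card_erase_of_mem, Finset.card_powersetCard, Finset.card_insert_of_notMem hz,
            t.card_eq]
          · rfl
          · exact Finset.mem_powersetCard.2 ⟨Finset.subset_insert _ _, t.card_eq⟩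
  · rw [← t.card_eq]
    refine Finset.card_le_card_of_injOn u hu fun s hs s' hs' h => ?_
    by_contra hne
    have hww : w s' = w s := hout _ (hu s hs) _ _ (hwt s hs) (hwt s' hs') (huw s hs)
      (by rw [h]; exact huw s' hs')
    exact hK ⟨w s, hwt s hs, Triangle.adj_of_two G hG (hu s hs) (hwt s hs) (huw s hs) (hws s hs)
      (hww ▸ hws s' hs') hne⟩

end Degree

/-! ### Total correctness with time bounds -/

/-- Started in `s`, the program `p` halts after at most `T` steps in a state satisfying `Q`. -/
def Ends (O : Subroutine) (p : Prog) (s : MState) (T : ℕ) (Q : MState → Prop) : Prop :=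
  ∃ s' t, Exec O p s s' t ∧ t ≤ T ∧ Q s'

/-- Writing a register. -/
def MState.setReg (s : MState) (x v : ℕ) : MState :=
  ⟨Function.update s.reg x v, s.arr⟩

/-- Writing an array cell. -/
def MState.setArr (s : MState) (a i j v : ℕ) : MState :=
  ⟨s.reg, Function.update s.arr a (Function.update (s.arr a) i
          (Function.update (s.arr a i) j v))⟩

@[simp] theorem MState.setReg_reg (s : MState) (x v y : ℕ) :
    (s.setReg x v).reg y = if y = x then v else s.reg y := by
  simp [MState.setReg, Function.update_apply]

@[simp] theorem MState.setReg_arr (s : MState) (x v : ℕ) : (s.setReg x v).arr = s.arr := rfl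

@[simp] theorem MState.setArr_reg (s : MState) (a i j v : ℕ) : (s.setArr a i j v).reg = s.reg := rfl

theorem MState.setArr_arr_of_ne (s : MState) {a b : ℕ} (h : b ≠ a) (i j v : ℕ) :
    (s.setArr a i j v).arr b = s.arr b := by
  simp [MState.setArr, h]

theorem MState.setArr_arr_self (s : MState) (a i j v i' j' : ℕ) :
    (s.setArr a i j v).arr a i' j' = if i' = i ∧ j' = j then v else s.arr a i' j' := by
  simp only [MState.setArr, Function.update_self, Function.update_apply]
  by_cases h : i' = i
  · subst h
    simp [Function.update_apply]
  · simp [h]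

@[simp] theorem MState.setArr_arr (s : MState) (a i j v b i' j' : ℕ) :
    (s.setArr a i j v).arr b i' j' =
      if b = a ∧ i' = i ∧ j' = j then v else s.arr b i' j' := by
  by_cases h : b = a
  · subst h
    simp [MState.setArr_arr_self]
  · simp [MState.setArr_arr_of_ne s h, h]

namespace Ends

variable {O : Subroutine} {p q : Prog} {s : MState} {T T₁ T₂ : ℕ} {Q Q₁ : MState → Prop}

theorem mono (h : Ends O p s T₁ Q₁) (hT : T₁ ≤ T) (hQ : ∀ s', Q₁ s' → Q s') : Ends O p s T Q := by
  obtain ⟨s', t, h1, h2, h3⟩ := h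
  exact ⟨s', t, h1, h2.trans hT, hQ s' h3⟩

theorem seq (h₁ : Ends O p s T₁ Q₁) (h₂ : ∀ s₁, Q₁ s₁ → Ends O q s₁ T₂ Q) :
    Ends O (.seq p q) s (T₁ + T₂) Q := by
  obtain ⟨s₁, t₁, e₁, b₁, q₁⟩ := h₁
  obtain ⟨s₂, t₂, e₂, b₂, q₂⟩ := h₂ s₁ q₁
  exact ⟨s₂, _, .seq e₁ e₂, Nat.add_le_add b₁ b₂, q₂⟩

theorem assign {x : ℕ} {e : Expr} (h : Q (s.setReg x (e.eval s))) :
    Ends O (.assign x e) s (e.cost + 1) Q :=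
  ⟨_, _, .assign x e s, le_rfl, h⟩

theorem put {a : ℕ} {i j e : Expr} (h : Q (s.setArr a (i.eval s) (j.eval s) (e.eval s))) :
    Ends O (.put a i j e) s (i.cost + j.cost + e.cost + 1) Q :=
  ⟨_, _, .put a i j e s, le_rfl, h⟩

theorem assign_seq {x : ℕ} {e : Expr} (h : Ends O q (s.setReg x (e.eval s)) T Q) :
    Ends O (.seq (.assign x e) q) s (e.cost + 1 + T) Q :=
  seq (Q₁ := fun s₁ => s₁ = s.setReg x (e.eval s)) (assign rfl) fun _ h' => h' ▸ h

theorem put_seq {a : ℕ} {i j e : Expr}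
    (h : Ends O q (s.setArr a (i.eval s) (j.eval s) (e.eval s)) T Q) :
    Ends O (.seq (.put a i j e) q) s (i.cost + j.cost + e.cost + 1 + T) Q :=
  seq (Q₁ := fun s₁ => s₁ = s.setArr a (i.eval s) (j.eval s) (e.eval s)) (put rfl)
    fun _ h' => h' ▸ h

theorem call {m : Expr} {a b : ℕ} {out : Arr} {t : ℕ} (ho : O (m.eval s) (s.arr a) out t)
    (h : Q ⟨s.reg, Function.update s.arr b out⟩) : Ends O (.call m a b) s (m.cost + 1 + t) Q :=
  ⟨_, _, .call m a b ho, le_rfl, h⟩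

end Ends

/-! ### Rules for bounded loops -/

/-- `for x = 0, …, N - 1` with the bound in register `N`. -/
def Prog.forLoop (x N : ℕ) (p : Prog) : Prog :=
  .seq (.assign x (.const 0))
    (.loop (.lt (.var x) (.var N)) (.seq p (.assign x (.add (.var x) (.const 1)))))

/-- Each round adds 4 steps for the test and 4 for the increment; the initialization and the last,
failing test take 6. The invariant `I k` refers to the state in which the counter already has the
value `k`. -/
theorem Ends.forLoop {O : Subroutine} {x N : ℕ} {p : Prog} {s : MState} {B T : ℕ}
    (I : ℕ → MState → Prop) (hxN : N ≠ x) (hB : s.reg N = B) (h0 : I 0 (s.setReg x 0))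
    (hstep : ∀ k s, k < B → s.reg x = k → s.reg N = B → I k s →
      Ends O p s T fun s' => s'.reg x = k ∧ s'.reg N = B ∧ I (k + 1) (s'.setReg x (k + 1))) :
    Ends O (.forLoop x N p) s (B * (T + 8) + 6) (I B) := by
  -- Induction on the number `d` of rounds still to come.
  have main : ∀ d k s, k + d = B → s.reg x = k → s.reg N = B → I k s →
      Ends O (.loop (.lt (.var x) (.var N)) (.seq p (.assign x (.add (.var x) (.const 1))))) s
        (d * (T + 8) + 4) (I B) := by
    intro d
    induction d with
    | zero =>
      intro k s hk hx hN hI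
      obtain rfl : k = B := by omega
      exact ⟨s, _, .loopFalse (by simp [Expr.eval, hx, hN]), by simp [Expr.cost], hI⟩
    | succ d ih =>
      intro k s hk hx hN hI
      obtain ⟨s₁, t₁, e₁, b₁, hx₁, hN₁, hI₁⟩ := hstep k s (by omega) hx hN hI
      obtain ⟨s₂, t₂, e₂, b₂, h₂⟩ := ih (k + 1) (s₁.setReg x (k + 1)) (by omega) (by simp)
        (by simp [hxN, hN₁]) hI₁
      have e₃ := Exec.assign (O := O) x (.add (.var x) (.const 1)) s₁
      simp only [Expr.eval, hx₁] at e₃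
      refine ⟨s₂, _, .loopTrue (by simp [Expr.eval, hx, hN]; omega) (.seq e₁ e₃) e₂, ?_, h₂⟩
      simp only [Expr.cost, Nat.succ_mul]
      omega
  have := main B 0 (s.setReg x 0) (by omega) (by simp) (by simp [hxN, hB]) h0
  refine (Ends.assign_seq (x := x) (e := .const 0) this).mono ?_ fun _ h => h
  simp only [Expr.cost]
  omega

/-- `acc := ∑ x < N, e`. -/
def Prog.sumLoop (acc x N : ℕ) (e : Expr) : Prog :=
  .seq (.assign acc (.const 0)) (.forLoop x N (.assign acc (.add (.var acc) e)))

/-- Only the counter and the accumulator change, so `e` may read the counter and anything else of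
`s` except the accumulator. -/
theorem Ends.sumLoop {O : Subroutine} {acc x N : ℕ} {e : Expr} {s : MState} {B : ℕ} (f : ℕ → ℕ)
    (hxN : N ≠ x) (haN : N ≠ acc) (hax : acc ≠ x) (hB : s.reg N = B)
    (hf : ∀ k < B, ∀ s', s'.arr = s.arr → s'.reg x = k →
      (∀ r, r ≠ x → r ≠ acc → s'.reg r = s.reg r) → e.eval s' = f k) :
    Ends O (.sumLoop acc x N e) s (B * (e.cost + 11) + 8) fun s' => s'.arr = s.arr ∧
      (∀ r, r ≠ x → r ≠ acc → s'.reg r = s.reg r) ∧ s'.reg acc = ∑ k ∈ Finset.range B, f k := by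
  refine (Ends.assign_seq (Ends.forLoop (B := B) (T := e.cost + 3) (fun k s' => s'.arr = s.arr ∧
      (∀ r, r ≠ x → r ≠ acc → s'.reg r = s.reg r) ∧ s'.reg acc = ∑ k ∈ Finset.range k, f k)
      hxN ?_ ?_ ?_)).mono ?_ fun _ h => h
  · simp [haN, hB]
  · refine ⟨rfl, ?_, ?_⟩
    · intro r h1 h2
      simp [h1, h2]
    · simp [hax, Expr.eval]
  · rintro k s' hk hx hN ⟨h1, h2, h3⟩
    refine (Ends.assign ?_).mono (T₁ := Expr.cost (.add (.var acc) e) + 1) ?_ fun _ h => h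
    · refine ⟨by simp [hax.symm, hx], by simp [haN, hN], by simp [h1], ?_, ?_⟩
      · intro r hr1 hr2
        simp [hr1, hr2, h2]
      · simp [hax, Expr.eval, hf k hk s' h1 hx h2, h3, Finset.sum_range_succ]
    · simp only [Expr.cost]
      omega
  · simp only [Expr.cost, show e.cost + 3 + 8 = e.cost + 11 by rfl]
    omega

theorem ite_one_zero_le_one (p : Prop) [Decidable p] : (if p then 1 else 0) ≤ 1 := by
  split_ifs <;> simp

/-! ### Computing a defective coloring by local search -/

section Coloring

variable (a : ℕ → ℕ → ℕ) (n : ℕ) (c : ℕ → ℕ)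

/-- The number of neighbors of `v` that have the color of `v`. -/
def sameColorCount (v : ℕ) : ℕ :=
  ∑ w ∈ Finset.range n, if a v w + (if c v = c w then 1 else 0) = 2 then 1 else 0

/-- Twice the number of monochromatic edges. -/
def monochromaticCount : ℕ :=
  ∑ v ∈ Finset.range n, sameColorCount a n c v

/-- Every vertex has at most one neighbor of its own color. -/
def StableColoring : Prop :=
  ∀ v < n, sameColorCount a n c v < 2

/-- `a` is the adjacency matrix of a cubic graph on `{0, …, n - 1}`. -/
structure IsCubicMatrix : Prop where
  le_one : ∀ i j, a i j ≤ 1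
  symm : ∀ i j, a i j = a j i
  diag : ∀ i, a i i = 0
  sum_row : ∀ i < n, ∑ j ∈ Finset.range n, a i j = 3

variable {a n c}

theorem IsCubicMatrix.monochromaticCount_le (ha : IsCubicMatrix a n) :
    monochromaticCount a n c ≤ 3 * n := by
  have : ∀ v ∈ Finset.range n, sameColorCount a n c v ≤ 3 := by
    intro v hv
    rw [← ha.sum_row v (Finset.mem_range.1 hv)]
    refine Finset.sum_le_sum fun w _ => ?_
    have := ha.le_one v w
    split_ifs <;> omega
  have := Finset.sum_le_card_nsmul _ _ _ this
  simpa [monochromaticCount, mul_comm] using this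

/-- Separates the row and the column of `v`, equal by symmetry, from the part that recoloring `v`
leaves alone. -/
theorem sum_sum_eq_of_symm {g : ℕ → ℕ → ℕ} {s : Finset ℕ} {v : ℕ} (hv : v ∈ s)
    (hs : ∀ x y, g x y = g y x) (hd : g v v = 0) :
    ∑ x ∈ s, ∑ y ∈ s, g x y =
      2 * ∑ y ∈ s.erase v, g v y + ∑ x ∈ s.erase v, ∑ y ∈ s.erase v, g x y := by
  have h : ∀ x, ∑ y ∈ s, g x y = g x v + ∑ y ∈ s.erase v, g x y := fun x =>
    (Finset.add_sum_erase s _ hv).symm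
  rw [← Finset.add_sum_erase s _ hv]
  simp only [h, hd, Finset.sum_add_distrib]
  rw [Finset.sum_congr rfl fun x _ => hs x v]
  ring

/-- A flip exchanges the neighbors of equal and of opposite color. They are three in all, so at
least two of equal color become at most one. -/
theorem IsCubicMatrix.monochromaticCount_flip_lt (ha : IsCubicMatrix a n) (hc : ∀ v, c v ≤ 1)
    {v : ℕ} (hv : v < n) (h2 : 2 ≤ sameColorCount a n c v) :
    monochromaticCount a n (Function.update c v (1 - c v)) < monochromaticCount a n c := by
  have hvr := Finset.mem_range.2 hv
  have key : ∀ c : ℕ → ℕ, monochromaticCount a n c =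
      2 * ∑ y ∈ (Finset.range n).erase v, (if a v y + (if c v = c y then 1 else 0) = 2 then 1 else 0)
      + ∑ x ∈ (Finset.range n).erase v, ∑ y ∈ (Finset.range n).erase v,
        (if a x y + (if c x = c y then 1 else 0) = 2 then 1 else 0) := by
    intro c
    refine sum_sum_eq_of_symm hvr (g := fun x y =>
      if a x y + (if c x = c y then 1 else 0) = 2 then 1 else 0) (fun x y => ?_) ?_
    · simp only [ha.symm x y, eq_comm]
    · simp [ha.diag]
  rw [key, key]
  have hrest : ∑ x ∈ (Finset.range n).erase v, ∑ y ∈ (Finset.range n).erase v,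
        (if a x y + (if Function.update c v (1 - c v) x = Function.update c v (1 - c v) y
          then 1 else 0) = 2 then 1 else 0) =
      ∑ x ∈ (Finset.range n).erase v, ∑ y ∈ (Finset.range n).erase v,
        (if a x y + (if c x = c y then 1 else 0) = 2 then 1 else 0) := by
    refine Finset.sum_congr rfl fun x hx => Finset.sum_congr rfl fun y hy => ?_
    rw [Function.update_of_ne (Finset.ne_of_mem_erase hx),
      Function.update_of_ne (Finset.ne_of_mem_erase hy)]
  rw [hrest]
  have hsum : ∑ y ∈ (Finset.range n).erase v,
        (if a v y + (if Function.update c v (1 - c v) v = Function.update c v (1 - c v) y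
          then 1 else 0) = 2 then 1 else 0) +
      ∑ y ∈ (Finset.range n).erase v, (if a v y + (if c v = c y then 1 else 0) = 2 then 1 else 0) =
      3 := by
    rw [← ha.sum_row v hv, ← Finset.add_sum_erase _ _ hvr, ha.diag, zero_add,
      ← Finset.sum_add_distrib]
    refine Finset.sum_congr rfl fun y hy => ?_
    rw [Function.update_self, Function.update_of_ne (Finset.ne_of_mem_erase hy)]
    have := hc v
    have := hc y
    have := ha.le_one v y
    split_ifs <;> omega
  have h2' : 2 ≤ ∑ y ∈ (Finset.range n).erase v,
      (if a v y + (if c v = c y then 1 else 0) = 2 then 1 else 0) := by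
    rw [sameColorCount, ← Finset.add_sum_erase _ _ hvr] at h2
    simpa [ha.diag] using h2
  omega

end Coloring

/-- Counts the neighbors of `v` (register `4`) of its own color into register `6`. -/
def countSameProg : Prog :=
  .sumLoop 6 5 0 (.eq (.add (.get 0 (.var 4) (.var 5))
    (.eq (.get 2 (.var 4) (.const 0)) (.get 2 (.var 5) (.const 0)))) (.const 2))

/-- Flips, one after the other, the vertices with at least two neighbors of their own color. -/
def colorPassProg : Prog :=
  .forLoop 4 0 (.seq countSameProg (.put 2 (.var 4) (.const 0)
    (.eq (.get 2 (.var 4) (.const 0)) (.lt (.var 6) (.const 2)))))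

/-- Computes a defective coloring of the graph in array `0` in array `2`. -/
def colorProg : Prog :=
  .seq (.assign 2 (.add (.var 0) (.add (.var 0) (.add (.var 0) (.const 1)))))
    (.forLoop 3 2 colorPassProg)

theorem ends_countSameProg {O : Subroutine} {s : MState} {n v : ℕ} (hn : s.reg 0 = n)
    (hv : s.reg 4 = v) :
    Ends O countSameProg s (n * 24 + 8) fun s' => s'.arr = s.arr ∧
      (∀ r, r ≠ 5 → r ≠ 6 → s'.reg r = s.reg r) ∧
      s'.reg 6 = sameColorCount (s.arr 0) n (fun v => s.arr 2 v 0) v := by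
  refine (Ends.sumLoop (B := n) (fun w => if s.arr 0 v w + (if s.arr 2 v 0 = s.arr 2 w 0
    then 1 else 0) = 2 then 1 else 0) (by decide) (by decide) (by decide) hn ?_).mono ?_ ?_
  · intro w _ s' h1 h2 h3
    simp [Expr.eval, h1, h2, h3, hv]
  · simp [Expr.cost]
  · exact fun s' h => h

/-- Either the pass flips nothing, and then every vertex has passed the test with the same coloring,
or some flip lowers the count. The second alternative records instability, so that a stable coloring
is known to survive. -/
theorem ends_colorPassProg {O : Subroutine} {s : MState} {n : ℕ} (hn : s.reg 0 = n)
    (ha : IsCubicMatrix (s.arr 0) n) (hc : ∀ v, s.arr 2 v 0 ≤ 1) :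
    Ends O colorPassProg s (n * (n * 24 + 27) + 6) fun s' => (∀ b, b ≠ 2 → s'.arr b = s.arr b) ∧
      (∀ r < 4, s'.reg r = s.reg r) ∧ (∀ v, s'.arr 2 v 0 ≤ 1) ∧
      (((∀ v, s'.arr 2 v 0 = s.arr 2 v 0) ∧ StableColoring (s.arr 0) n fun v => s.arr 2 v 0) ∨
        (¬ StableColoring (s.arr 0) n (fun v => s.arr 2 v 0) ∧
          monochromaticCount (s.arr 0) n (fun v => s'.arr 2 v 0) <
            monochromaticCount (s.arr 0) n (fun v => s.arr 2 v 0))) := by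
  refine (Ends.forLoop (B := n) (T := (n * 24 + 8) + 11)
    (fun k s' => (∀ b, b ≠ 2 → s'.arr b = s.arr b) ∧
      (∀ r < 4, s'.reg r = s.reg r) ∧ (∀ v, s'.arr 2 v 0 ≤ 1) ∧
      (((∀ v, s'.arr 2 v 0 = s.arr 2 v 0) ∧
          ∀ v < k, sameColorCount (s.arr 0) n (fun v => s.arr 2 v 0) v < 2) ∨
        (¬ StableColoring (s.arr 0) n (fun v => s.arr 2 v 0) ∧
          monochromaticCount (s.arr 0) n (fun v => s'.arr 2 v 0) <
            monochromaticCount (s.arr 0) n (fun v => s.arr 2 v 0))))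
    (by decide) hn ?_ ?_).mono ?_ ?_
  · refine ⟨fun _ _ => rfl, ?_, hc, Or.inl ⟨fun _ => rfl, fun v hv => absurd hv (by omega)⟩⟩
    intro r hr
    simp [hr.ne]
  · rintro v s₁ hv h4 h0 ⟨i1, i2, i3, i4⟩
    refine ((ends_countSameProg h0 h4).seq (T₂ := 11) fun s₂ ⟨j1, j2, j3⟩ => ?_).mono le_rfl
      fun _ h => h
    refine (Ends.put ?_).mono (by simp [Expr.cost]) fun _ h => h
    have e4 : s₂.reg 4 = v := by rw [j2 4 (by decide) (by decide), h4]
    have e0 : s₂.reg 0 = n := by rw [j2 0 (by decide) (by decide), h0]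
    refine ⟨by simpa using e4, by simpa using e0, ?_, ?_, ?_, ?_⟩
    · intro b hb
      rw [MState.setReg_arr, MState.setArr_arr_of_ne _ hb, j1, i1 b hb]
    · intro r hr
      simp [hr.ne, j2 r (by omega) (by omega), i2 r hr]
    · intro w
      simp only [MState.setReg_arr, MState.setArr_arr, Expr.eval]
      have := i3 w
      rw [← j1] at this
      split
      · exact ite_one_zero_le_one _
      · exact this
    -- For a color in {0, 1}, comparing it with 1 keeps it and comparing it with 0 flips it; the
    -- test `count < 2` supplies the right constant.
    · have hcol : ∀ w, ((s₂.setArr 2 (Expr.eval s₂ (.var 4)) (Expr.eval s₂ (.const 0)) (Expr.eval s₂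
          (.eq (.get 2 (.var 4) (.const 0)) (.lt (.var 6) (.const 2))))).setReg 4 (v + 1)).arr 2 w 0
          = if w = v ∧ 2 ≤ sameColorCount (s.arr 0) n (fun v => s₁.arr 2 v 0) v then
            1 - s₁.arr 2 v 0 else s₁.arr 2 w 0 := by
        intro w
        rw [i1 0 (by decide)] at j3
        simp only [MState.setReg_arr, MState.setArr_arr, Expr.eval, e4, j3, j1]
        have := i3 v
        by_cases hw : w = v
        · subst hw
          by_cases h2 : sameColorCount (s.arr 0) n (fun v => s₁.arr 2 v 0) w < 2
          · have h2' := h2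
            rw [← not_le] at h2'
            simp only [h2, h2', if_true, if_false, and_self, and_false]
            split_ifs <;> omega
          · simp [h2, not_lt.1 h2]
            split_ifs <;> omega
        · simp [hw]
      by_cases h2 : 2 ≤ sameColorCount (s.arr 0) n (fun v => s₁.arr 2 v 0) v
      · simp only [h2, and_true] at hcol
        right
        have hlt := ha.monochromaticCount_flip_lt (c := fun v => s₁.arr 2 v 0) i3 hv h2
        have hup : Function.update (fun v => s₁.arr 2 v 0) v (1 - s₁.arr 2 v 0) =
            fun w => if w = v then 1 - s₁.arr 2 v 0 else s₁.arr 2 w 0 := by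
          ext w
          simp [Function.update_apply]
        simp only [hcol]
        rw [hup] at hlt
        rcases i4 with ⟨k1, k2⟩ | ⟨k1, k2⟩
        · simp only [k1] at hlt h2 ⊢
          exact ⟨fun hst => absurd (hst v hv) (by omega), hlt⟩
        · exact ⟨k1, hlt.trans k2⟩
      · simp only [h2, and_false, if_false] at hcol
        simp only [hcol]
        rcases i4 with ⟨k1, k2⟩ | h
        · left
          refine ⟨k1, fun w hw => ?_⟩
          rcases Nat.lt_succ_iff_lt_or_eq.1 hw with hw | rfl
          · exact k2 w hw
          · simp only [k1] at h2
            omega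
        · exact Or.inr h
  · exact le_of_eq (by ring)
  · exact fun s' h => h

/-- The count starts at most `3n` and drops in every pass until the coloring is stable, so `3n + 1`
passes suffice. -/
theorem ends_colorProg {O : Subroutine} {s : MState} {n : ℕ} (hn : s.reg 0 = n)
    (ha : IsCubicMatrix (s.arr 0) n) (hc : ∀ v, s.arr 2 v 0 = 0) :
    Ends O colorProg s ((3 * n + 1) * (n * (n * 24 + 27) + 14) + 14) fun s' =>
      (∀ b, b ≠ 2 → s'.arr b = s.arr b) ∧ s'.reg 0 = n ∧
      (∀ v, s'.arr 2 v 0 ≤ 1) ∧ StableColoring (s.arr 0) n fun v => s'.arr 2 v 0 := by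
  refine (Ends.assign_seq (Ends.forLoop (B := 3 * n + 1) (T := n * (n * 24 + 27) + 6)
    (fun k s' => (∀ b, b ≠ 2 → s'.arr b = s.arr b) ∧ s'.reg 0 = n ∧
      (∀ v, s'.arr 2 v 0 ≤ 1) ∧ (StableColoring (s.arr 0) n (fun v => s'.arr 2 v 0) ∨
        monochromaticCount (s.arr 0) n (fun v => s'.arr 2 v 0) + k ≤ 3 * n))
    (by decide) ?_ ?_ ?_)).mono ?_ ?_
  · simp [Expr.eval, hn]
    ring
  · refine ⟨fun _ _ => rfl, by simpa using hn, fun v => by simp [hc], Or.inr ?_⟩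
    exact ha.monochromaticCount_le
  · rintro k s₁ hk h3 h2 ⟨i1, i2, i3, i4⟩
    have e0 := i1 0 (by decide)
    refine (ends_colorPassProg i2 (e0 ▸ ha) i3).mono le_rfl fun s₂ ⟨j1, j2, j3, j4⟩ => ?_
    refine ⟨by rw [j2 3 (by decide), h3], by rw [j2 2 (by decide), h2], ?_, ?_, j3, ?_⟩
    · intro b hb
      rw [MState.setReg_arr, j1 b hb, i1 b hb]
    · simp [j2 0 (by decide), i2]
    · rw [e0] at j4
      simp only [MState.setReg_arr]
      rcases j4 with ⟨k1, k2⟩ | ⟨k1, k2⟩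
      · left
        simpa only [k1] using k2
      · right
        have := i4.resolve_left k1
        omega
  · simp only [Expr.cost]
    exact le_of_eq (by ring)
  · rintro s' ⟨h1, h2, h3, h4⟩
    exact ⟨h1, h2, h3, h4.resolve_right (by omega)⟩

/-! ### Listing the triangles -/

section TripleList

variable (a : ℕ → ℕ → ℕ) (n : ℕ)

/-- `i < j < k` span a triangle of the graph with adjacency matrix `a`. -/
def IsTriple (i j k : ℕ) : Prop :=
  (if i < j then 1 else 0) + ((if j < k then 1 else 0) + (a i j + (a j k + a i k))) = 5

instance (i j k : ℕ) : Decidable (IsTriple a i j k) :=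
  inferInstanceAs (Decidable (_ = 5))

/-- Five terms of value at most 1 add up to 5 only if all equal 1: a sum replaces the conjunction
that expressions lack. -/
theorem isTriple_iff {a : ℕ → ℕ → ℕ} (ha : ∀ i j, a i j ≤ 1) (i j k : ℕ) :
    IsTriple a i j k ↔ i < j ∧ j < k ∧ a i j = 1 ∧ a j k = 1 ∧ a i k = 1 := by
  unfold IsTriple
  have := ha i j
  have := ha j k
  have := ha i k
  split_ifs <;> omega

/-- The triangles `i < j < k` of the graph with adjacency matrix `a`, for given `i` and `j`. -/
def triplesWith₂ (i j K : ℕ) : List (ℕ × ℕ × ℕ) :=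
  (List.range K).flatMap fun k => if IsTriple a i j k then [(i, j, k)] else []

/-- The triangles `i < j < k < n` of the graph with adjacency matrix `a`, for given `i`. -/
def triplesWith₁ (i J : ℕ) : List (ℕ × ℕ × ℕ) :=
  (List.range J).flatMap fun j => triplesWith₂ a i j n

/-- The triangles `i < j < k < n` of the graph with adjacency matrix `a`. -/
def triples (I : ℕ) : List (ℕ × ℕ × ℕ) :=
  (List.range I).flatMap fun i => triplesWith₁ a n i n

theorem mem_triples {t : ℕ × ℕ × ℕ} : t ∈ triples a n n ↔
    t.1 < n ∧ t.2.1 < n ∧ t.2.2 < n ∧ IsTriple a t.1 t.2.1 t.2.2 := by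
  obtain ⟨i, j, k⟩ := t
  simp only [triples, triplesWith₁, triplesWith₂, List.mem_flatMap, List.mem_range]
  constructor
  · rintro ⟨i', hi, j', hj, k', hk, h⟩
    split_ifs at h with h'
    · simp only [List.mem_singleton, Prod.mk.injEq] at h
      obtain ⟨rfl, rfl, rfl⟩ := h
      exact ⟨hi, hj, hk, h'⟩
    · simp at h
  · rintro ⟨hi, hj, hk, h⟩
    exact ⟨i, hi, j, hj, k, hk, by simp [h]⟩

theorem nodup_flatMap_range {β : Type*} {K : ℕ} {f : ℕ → List β} (hf : ∀ k, (f k).Nodup)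
    (p : β → ℕ) (hp : ∀ k, ∀ x ∈ f k, p x = k) : ((List.range K).flatMap f).Nodup := by
  rw [List.nodup_flatMap]
  refine ⟨fun k _ => hf k, List.nodup_range.imp fun {k l} hkl => ?_⟩
  intro x hx hx'
  exact hkl ((hp k x hx).symm.trans (hp l x hx'))

theorem nodup_triples : (triples a n n).Nodup := by
  refine nodup_flatMap_range (fun i => ?_) (fun t => t.1) ?_
  · refine nodup_flatMap_range (fun j => ?_) (fun t => t.2.1) ?_
    · refine nodup_flatMap_range (fun k => ?_) (fun t => t.2.2) ?_
      · split_ifs <;> simp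
      · intro k x hx
        split_ifs at hx <;> simp_all
    · intro j x hx
      obtain ⟨k, -, hx⟩ := List.mem_flatMap.1 hx
      split_ifs at hx <;> simp_all
  · intro j x hx
    obtain ⟨j, -, hx⟩ := List.mem_flatMap.1 hx
    obtain ⟨k, -, hx⟩ := List.mem_flatMap.1 hx
    split_ifs at hx <;> simp_all

theorem length_triples_le : (triples a n n).length ≤ n ^ 3 := by
  have hsub : (triples a n n).toFinset ⊆
      Finset.range n ×ˢ (Finset.range n ×ˢ Finset.range n) := by
    intro t ht
    obtain ⟨h1, h2, h3, -⟩ := (mem_triples a n).1 (List.mem_toFinset.1 ht)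
    simp [h1, h2, h3]
  have := Finset.card_le_card hsub
  rw [List.toFinset_card_of_nodup (nodup_triples a n)] at this
  refine this.trans (le_of_eq ?_)
  simp only [Finset.card_product, Finset.card_range]
  ring

end TripleList

/-- Register `1` and array `3` hold the list `L`. -/
def HoldsList (s : MState) (L : List (ℕ × ℕ × ℕ)) : Prop :=
  s.reg 1 = L.length ∧
    ∀ q t, L[q]? = some t → s.arr 3 q 0 = t.1 ∧ s.arr 3 q 1 = t.2.1 ∧ s.arr 3 q 2 = t.2.2

/-- Appends the numbers in the registers `2`, `3`, `4` to the list if they form a triangle. -/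
def appendTripleProg : Prog :=
  .seq (.put 3 (.var 1) (.const 0) (.var 2)) (.seq (.put 3 (.var 1) (.const 1) (.var 3))
    (.seq (.put 3 (.var 1) (.const 2) (.var 4)) (.assign 1 (.add (.var 1)
      (.eq (.add (.lt (.var 2) (.var 3)) (.add (.lt (.var 3) (.var 4))
        (.add (.get 0 (.var 2) (.var 3)) (.add (.get 0 (.var 3) (.var 4))
          (.get 0 (.var 2) (.var 4)))))) (.const 5))))))

/-- Lists the triangles of the graph in array `0`. -/
def listProg : Prog :=
  .seq (.assign 1 (.const 0)) (.forLoop 2 0 (.forLoop 3 0 (.forLoop 4 0 appendTripleProg)))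

/-- The triple is written behind the list in any case, and only the length depends on the test. A
rejected triple stays beyond the end, where `HoldsList` asserts nothing. -/
theorem ends_appendTripleProg {O : Subroutine} {s : MState} {L : List (ℕ × ℕ × ℕ)} {i j k : ℕ}
    (hi : s.reg 2 = i) (hj : s.reg 3 = j) (hk : s.reg 4 = k) (hL : HoldsList s L) :
    Ends O appendTripleProg s 36 fun s' => (∀ b, b ≠ 3 → s'.arr b = s.arr b) ∧
      (∀ r, r ≠ 1 → s'.reg r = s.reg r) ∧
      HoldsList s' (L ++ if IsTriple (s.arr 0) i j k then [(i, j, k)] else []) := by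
  refine (Ends.put_seq (Ends.put_seq (Ends.put_seq (Ends.assign ?_)))).mono
    (by simp [Expr.cost]) fun _ h => h
  obtain ⟨hm, hL⟩ := hL
  refine ⟨?_, ?_, ?_, ?_⟩
  · intro b hb
    simp only [MState.setReg_arr, MState.setArr_arr_of_ne _ hb]
  · intro r hr
    simp [hr]
  · simp only [Expr.eval, MState.setReg_reg, MState.setArr_reg, MState.setArr_arr, hi, hj, hk, hm,
      if_true, List.length_append]
    simp only [OfNat.zero_ne_ofNat, false_and, if_false, IsTriple]
    split_ifs <;> rfl
  · intro q t hq
    simp only [Expr.eval, MState.setReg_arr, MState.setArr_reg, MState.setArr_arr, hi, hj, hk, hm]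
    rcases lt_or_ge q L.length with h | h
    · rw [List.getElem?_append_left h] at hq
      simpa [h.ne] using hL q t hq
    · rw [List.getElem?_append_right h] at hq
      split_ifs at hq with hT
      · obtain ⟨h0, h1⟩ : q - L.length = 0 ∧ (i, j, k) = t := by
          rcases Nat.eq_zero_or_pos (q - L.length) with h' | h'
          · exact ⟨h', by simpa [h'] using hq⟩
          · rw [List.getElem?_eq_none (by simp only [List.length_singleton]; omega)] at hq
            simp at hq
        obtain rfl : q = L.length := by omega
        subst h1
        simp
      · simp at hq

theorem ends_listProg {O : Subroutine} {s : MState} {n : ℕ} (hn : s.reg 0 = n) :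
    Ends O listProg s (n * (n * (n * 44 + 14) + 14) + 8) fun s' =>
      (∀ b, b ≠ 3 → s'.arr b = s.arr b) ∧ s'.reg 0 = n ∧
      HoldsList s' (triples (s.arr 0) n n) := by
  -- An arbitrary initial list `L` lets the inner loops serve as bodies of the outer ones.
  have inner : ∀ (s : MState) (L : List (ℕ × ℕ × ℕ)) (i j : ℕ), s.reg 0 = n → s.reg 2 = i →
      s.reg 3 = j → HoldsList s L → Ends O (.forLoop 4 0 appendTripleProg) s (n * 44 + 6) fun s' =>
        (∀ b, b ≠ 3 → s'.arr b = s.arr b) ∧ (∀ r, r ≠ 1 → r ≠ 4 → s'.reg r = s.reg r) ∧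
        HoldsList s' (L ++ triplesWith₂ (s.arr 0) i j n) := by
    intro s L i j h0 h2 h3 hL
    refine Ends.forLoop (T := 36) (fun k s' => (∀ b, b ≠ 3 → s'.arr b = s.arr b) ∧
      (∀ r, r ≠ 1 → r ≠ 4 → s'.reg r = s.reg r) ∧
        HoldsList s' (L ++ triplesWith₂ (s.arr 0) i j k)) (by decide) h0 ?_ ?_
    · refine ⟨fun _ _ => rfl, fun r _ hr => by simp [hr], ?_⟩
      simpa [triplesWith₂, HoldsList] using hL
    · rintro k s₁ - e4 e0 ⟨i1, i2, i3⟩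
      refine (ends_appendTripleProg ((i2 2 (by decide) (by decide)).trans h2)
        ((i2 3 (by decide) (by decide)).trans h3) e4 i3).mono le_rfl fun s₂ ⟨j1, j2, j3⟩ => ?_
      refine ⟨(j2 4 (by decide)).trans e4, (j2 0 (by decide)).trans e0,
        fun b hb => (j1 b hb).trans (i1 b hb), fun r hr hr' => ?_, ?_⟩
      · simpa [hr'] using (j2 r hr).trans (i2 r hr hr')
      · rw [i1 0 (by decide)] at j3
        simpa [triplesWith₂, HoldsList, List.range_succ, List.flatMap_append] using j3
  have middle : ∀ (s : MState) (L : List (ℕ × ℕ × ℕ)) (i : ℕ), s.reg 0 = n → s.reg 2 = i →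
      HoldsList s L → Ends O (.forLoop 3 0 (.forLoop 4 0 appendTripleProg)) s
        (n * (n * 44 + 14) + 6) fun s' =>
        (∀ b, b ≠ 3 → s'.arr b = s.arr b) ∧ (∀ r, r ≠ 1 → r ≠ 4 → r ≠ 3 → s'.reg r = s.reg r) ∧
        HoldsList s' (L ++ triplesWith₁ (s.arr 0) n i n) := by
    intro s L i h0 h2 hL
    refine Ends.forLoop (T := n * 44 + 6) (fun k s' => (∀ b, b ≠ 3 → s'.arr b = s.arr b) ∧
      (∀ r, r ≠ 1 → r ≠ 4 → r ≠ 3 → s'.reg r = s.reg r) ∧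
        HoldsList s' (L ++ triplesWith₁ (s.arr 0) n i k)) (by decide) h0 ?_ ?_
    · refine ⟨fun _ _ => rfl, fun r _ _ hr => by simp [hr], ?_⟩
      simpa [triplesWith₁, HoldsList] using hL
    · rintro k s₁ - e3 e0 ⟨i1, i2, i3⟩
      refine (inner s₁ _ i k e0 ((i2 2 (by decide) (by decide) (by decide)).trans h2) e3 i3).mono
        le_rfl fun s₂ ⟨j1, j2, j3⟩ => ?_
      refine ⟨(j2 3 (by decide) (by decide)).trans e3, (j2 0 (by decide) (by decide)).trans e0,
        fun b hb => (j1 b hb).trans (i1 b hb), fun r hr hr' hr'' => ?_, ?_⟩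
      · simpa [hr''] using (j2 r hr hr').trans (i2 r hr hr' hr'')
      · rw [i1 0 (by decide)] at j3
        simpa [triplesWith₁, HoldsList, List.range_succ, List.flatMap_append] using j3
  refine (Ends.assign_seq (Ends.forLoop (B := n) (T := n * (n * 44 + 14) + 6) (fun k s' =>
    (∀ b, b ≠ 3 → s'.arr b = s.arr b) ∧ s'.reg 0 = n ∧
        HoldsList s' (triples (s.arr 0) n k)) (by decide) ?_ ?_ ?_)).mono ?_ fun _ h => h
  · simpa using hn
  · refine ⟨fun _ _ => rfl, by simpa using hn, ?_⟩
    simp [triples, HoldsList, Expr.eval]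
  · rintro k s₁ - e2 e0 ⟨i1, i2, i3⟩
    refine (middle s₁ _ k e0 e2 i3).mono le_rfl fun s₂ ⟨j1, j2, j3⟩ => ?_
    refine ⟨(j2 2 (by decide) (by decide) (by decide)).trans e2,
      (j2 0 (by decide) (by decide) (by decide)).trans e0,
      fun b hb => (j1 b hb).trans (i1 b hb), ?_, ?_⟩
    · simpa using (j2 0 (by decide) (by decide) (by decide)).trans e0
    · rw [i1 0 (by decide)] at j3
      simpa [triples, HoldsList, List.range_succ, List.flatMap_append] using j3
  · simp only [Expr.cost]
    exact le_of_eq (by ring)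

/-! ### Constructing the triangle graph -/

/-- The adjacency matrix of the triangle graph, for the graph with adjacency matrix `a` and the
list of triangles `l`. -/
def triangleMatrix (a l : ℕ → ℕ → ℕ) (i j : ℕ) : ℕ :=
  if (if i = j then 1 else 0) +
    (if ∑ p ∈ Finset.range 3, ∑ q ∈ Finset.range 3, a (l i p) (l j q) = 0 then 1 else 0) = 0
    then 1 else 0

/-- The entry of array `0` for the `p`-th vertex of triangle number `x` and the `q`-th vertex of
triangle number `y`, for registers `x` and `y`. -/
def adjEntryExpr (x y p q : ℕ) : Expr :=
  .get 0 (.get 3 (.var x) (.const p)) (.get 3 (.var y) (.const q))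

/-- The sum of three expressions. -/
def sumExpr₃ (f : ℕ → Expr) : Expr := .add (.add (f 0) (f 1)) (f 2)

theorem eval_sumExpr₃ (s : MState) (f : ℕ → Expr) :
    (sumExpr₃ f).eval s = ∑ p ∈ Finset.range 3, (f p).eval s := by
  simp [sumExpr₃, Expr.eval, Finset.sum_range_succ]

/-- Writes the adjacency matrix of the triangle graph into array `4`. -/
def matrixProg : Prog :=
  .forLoop 2 1 (.forLoop 3 1 (.put 4 (.var 2) (.var 3)
    (.eq (.add (.eq (.var 2) (.var 3))
      (.eq (sumExpr₃ fun p => sumExpr₃ fun q => adjEntryExpr 2 3 p q) (.const 0))) (.const 0))))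

/-- The cells outside the `m × m` square matter too, because the subroutine receives the whole
array; hence the assumption that array 4 starts empty. -/
theorem ends_matrixProg {O : Subroutine} {s : MState} {m : ℕ} (hm : s.reg 1 = m)
    (h4 : ∀ i j, s.arr 4 i j = 0) :
    Ends O matrixProg s (m * (m * 90 + 14) + 6) fun s' =>
      (∀ b, b ≠ 4 → s'.arr b = s.arr b) ∧ s'.reg 0 = s.reg 0 ∧ s'.reg 1 = m ∧
      ∀ i j, s'.arr 4 i j = if i < m ∧ j < m then triangleMatrix (s.arr 0) (s.arr 3) i j else 0 := by
  refine Ends.forLoop (T := m * 90 + 6) (fun k s' => (∀ b, b ≠ 4 → s'.arr b = s.arr b) ∧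
    s'.reg 0 = s.reg 0 ∧ s'.reg 1 = m ∧ ∀ i j, s'.arr 4 i j =
      if i < k ∧ j < m then triangleMatrix (s.arr 0) (s.arr 3) i j else 0) (by decide) hm ?_ ?_
  · exact ⟨fun _ _ => rfl, by simp, by simpa using hm, fun i j => by simp [h4]⟩
  rintro k s₁ hk e2 e1 ⟨i1, i2, i3, i4⟩
  refine (Ends.forLoop (T := 82) (fun l s' => (∀ b, b ≠ 4 → s'.arr b = s.arr b) ∧
    s'.reg 0 = s.reg 0 ∧ s'.reg 1 = m ∧ s'.reg 2 = k ∧ ∀ i j, s'.arr 4 i j =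
      if (i < k ∧ j < m) ∨ (i = k ∧ j < l) then triangleMatrix (s.arr 0) (s.arr 3) i j else 0)
      (by decide) e1 ?_ ?_).mono le_rfl ?_
  · exact ⟨i1, by simpa using i2, by simpa using i3, by simpa using e2, fun i j => by simp [i4]⟩
  · rintro l s₂ hl f3 f1 ⟨j1, j2, j3, j4, j5⟩
    refine (Ends.put ?_).mono (by simp [Expr.cost, sumExpr₃, adjEntryExpr]) fun _ h => h
    refine ⟨by simpa using f3, by simpa using f1, ?_, by simpa using j2, by simpa using j3,
      by simpa using j4, ?_⟩
    · intro b hb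
      rw [MState.setReg_arr, MState.setArr_arr_of_ne _ hb, j1 b hb]
    · intro i j
      simp only [Expr.eval, eval_sumExpr₃, adjEntryExpr, MState.setReg_arr, MState.setArr_arr,
        j4, f3, j5, j1 0 (by decide), j1 3 (by decide)]
      by_cases h : i = k ∧ j = l
      · obtain ⟨rfl, rfl⟩ := h
        simp [triangleMatrix]
      · have : (i < k ∧ j < m ∨ i = k ∧ j < l + 1) ↔ (i < k ∧ j < m ∨ i = k ∧ j < l) := by omega
        rw [if_neg (by simpa using h), if_congr this rfl rfl]
  · rintro s₂ ⟨j1, j2, j3, j4, j5⟩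
    refine ⟨j4, j3, j1, by simpa using j2, by simpa using j3, fun i j => ?_⟩
    rw [MState.setReg_arr, j5]
    have : (i < k ∧ j < m ∨ i = k ∧ j < m) ↔ (i < k + 1 ∧ j < m) := by omega
    simp only [this]

/-! ### The vertices off the chosen triangles, and the output -/

theorem ite_add_ite_eq_two_eq_zero_iff (p q : Prop) [Decidable p] [Decidable q] :
    (if (if p then 1 else 0) + (if q then 1 else 0) = 2 then 1 else 0) = 0 ↔ (p → ¬ q) := by
  by_cases hp : p <;> by_cases hq : q <;> simp [hp, hq]

/-- Marks in array `6` the vertices that lie on no chosen triangle. -/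
def markProg : Prog :=
  .forLoop 2 0 (.seq
    (.sumLoop 5 3 1 (.eq (.add (.lt (.const 0) (.get 5 (.var 3) (.const 0)))
      (.lt (.const 0) (sumExpr₃ fun p => .eq (.get 3 (.var 3) (.const p)) (.var 2)))) (.const 2)))
    (.put 6 (.var 2) (.const 0) (.eq (.var 5) (.const 0))))

theorem ends_markProg {O : Subroutine} {s : MState} {n m : ℕ} (hn : s.reg 0 = n)
    (hm : s.reg 1 = m) :
    Ends O markProg s (n * (m * 38 + 23) + 6) fun s' =>
      (∀ b, b ≠ 6 → s'.arr b = s.arr b) ∧ s'.reg 0 = n ∧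
      ∀ v < n, s'.arr 6 v 0 ≤ 1 ∧ (s'.arr 6 v 0 = 1 ↔
        ∀ q < m, s.arr 5 q 0 ≠ 0 → ∀ p < 3, s.arr 3 q p ≠ v) := by
  refine (Ends.forLoop (B := n) (T := (m * 38 + 8) + 7) (fun k s' =>
    (∀ b, b ≠ 6 → s'.arr b = s.arr b) ∧ s'.reg 0 = n ∧ s'.reg 1 = m ∧
      ∀ v < k, s'.arr 6 v 0 ≤ 1 ∧ (s'.arr 6 v 0 = 1 ↔
        ∀ q < m, s.arr 5 q 0 ≠ 0 → ∀ p < 3, s.arr 3 q p ≠ v)) (by decide) hn ?_ ?_).mono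
    (le_of_eq (by ring)) fun s' ⟨h1, h2, _, h4⟩ => ⟨h1, h2, h4⟩
  · exact ⟨fun _ _ => rfl, by simpa using hn, by simpa using hm, fun v hv => absurd hv (by omega)⟩
  rintro v s₁ hv e2 e0 ⟨i1, i2, i3, i4⟩
  -- The subroutine may mark membership by any nonzero value, so its entries are only tested for
  -- being positive.
  refine ((Ends.sumLoop (B := m) (fun q => if (if 0 < s.arr 5 q 0 then 1 else 0) +
    (if 0 < ∑ p ∈ Finset.range 3, (if s.arr 3 q p = v then 1 else 0) then 1 else 0) = 2
      then 1 else 0) (by decide) (by decide) (by decide) i3 ?_).seq (T₂ := 7)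
      fun s₂ ⟨j1, j2, j3⟩ => ?_).mono (by simp [Expr.cost, sumExpr₃]) fun _ h => h
  · intro q _ s₂ k1 k2 k3
    have k4 : s₂.reg 2 = v := (k3 2 (by decide) (by decide)).trans e2
    simp only [Expr.eval, eval_sumExpr₃, k1, k2, k4, i1 3 (by decide), i1 5 (by decide)]
  · refine (Ends.put ?_).mono (by simp [Expr.cost]) fun _ h => h
    have f2 : s₂.reg 2 = v := (j2 2 (by decide) (by decide)).trans e2
    have f0 : s₂.reg 0 = n := (j2 0 (by decide) (by decide)).trans e0
    have f1 : s₂.reg 1 = m := (j2 1 (by decide) (by decide)).trans i3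
    refine ⟨by simpa using f2, by simpa using f0, ?_, by simpa using f0, by simpa using f1, ?_⟩
    · intro b hb
      rw [MState.setReg_arr, MState.setArr_arr_of_ne _ hb, j1, i1 b hb]
    · intro w hw
      simp only [Expr.eval, MState.setReg_arr, MState.setArr_arr, f2, j1, j3, true_and, and_true]
      rcases Nat.lt_succ_iff_lt_or_eq.1 hw with hw | rfl
      · simpa only [hw.ne, if_false] using i4 w hw
      · rw [if_pos rfl]
        refine ⟨ite_one_zero_le_one _, ?_⟩
        rw [ite_eq_left_iff]
        simp only [zero_ne_one, imp_false, not_not, Finset.sum_eq_zero_iff, Finset.mem_range]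
        refine forall₂_congr fun q _ => ?_
        have h3 : (0 < ∑ p ∈ Finset.range 3, if s.arr 3 q p = w then 1 else 0) ↔
            ¬ ∀ p < 3, s.arr 3 q p ≠ w := by
          rw [Nat.pos_iff_ne_zero, not_iff_not]
          simp
        rw [ite_add_ite_eq_two_eq_zero_iff, h3, not_not, Nat.pos_iff_ne_zero]

/-- Writes the smaller one of the smaller color class and the marked set into array `1`. -/
def selectProg : Prog :=
  .seq (.sumLoop 7 2 0 (.get 2 (.var 2) (.const 0)))
  (.seq (.assign 8 (.eq (.lt (.var 0) (.add (.var 7) (.var 7))) (.const 0)))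
  (.seq (.sumLoop 9 2 0 (.eq (.get 2 (.var 2) (.const 0)) (.var 8)))
  (.seq (.sumLoop 10 2 0 (.get 6 (.var 2) (.const 0)))
  (.seq (.assign 11 (.lt (.var 10) (.var 9)))
  (.forLoop 2 0 (.put 1 (.var 2) (.const 0)
    (.add (.lt (.var 11) (.eq (.get 2 (.var 2) (.const 0)) (.var 8)))
      (.eq (.add (.var 11) (.get 6 (.var 2) (.const 0))) (.const 2)))))))))

/-- The chosen color is 1 unless that class contains more than half of the vertices. -/
theorem two_mul_sum_class_le {n : ℕ} {c : ℕ → ℕ} (hc : ∀ v < n, c v ≤ 1) :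
    2 * ∑ v ∈ Finset.range n, (if c v = (if (if n < (∑ v ∈ Finset.range n, c v) +
      ∑ v ∈ Finset.range n, c v then 1 else 0) = 0 then 1 else 0) then 1 else 0) ≤ n := by
  have h1 : ∑ v ∈ Finset.range n, (if c v = 1 then 1 else 0) = ∑ v ∈ Finset.range n, c v :=
    Finset.sum_congr rfl fun v hv => by
      have := hc v (Finset.mem_range.1 hv)
      split_ifs <;> omega
  have h0 : ∑ v ∈ Finset.range n, (if c v = 0 then 1 else 0) + ∑ v ∈ Finset.range n, c v = n := by
    rw [← Finset.sum_add_distrib]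
    calc _ = ∑ v ∈ Finset.range n, 1 := Finset.sum_congr rfl fun v hv => by
          have := hc v (Finset.mem_range.1 hv)
          split_ifs <;> omega
      _ = n := by simp
  by_cases h : n < (∑ v ∈ Finset.range n, c v) + ∑ v ∈ Finset.range n, c v
  · simp only [h, if_true, one_ne_zero, if_false]
    omega
  · simp only [h, if_true, if_false, h1]
    omega

theorem ends_selectProg {O : Subroutine} {s : MState} {n : ℕ} (hn : s.reg 0 = n)
    (hc : ∀ v < n, s.arr 2 v 0 ≤ 1) (hf : ∀ v < n, s.arr 6 v 0 ≤ 1) :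
    Ends O selectProg s (n * 70 + 50) fun s' => ∃ i ≤ 1,
      2 * ∑ v ∈ Finset.range n, (if s.arr 2 v 0 = i then 1 else 0) ≤ n ∧
      ∀ v < n, s'.arr 1 v 0 =
        if ∑ v ∈ Finset.range n, s.arr 6 v 0 <
          ∑ v ∈ Finset.range n, (if s.arr 2 v 0 = i then 1 else 0)
        then s.arr 6 v 0 else if s.arr 2 v 0 = i then 1 else 0 := by
  obtain ⟨i, hi⟩ : ∃ i, i = if (if n < (∑ v ∈ Finset.range n, s.arr 2 v 0) +
      ∑ v ∈ Finset.range n, s.arr 2 v 0 then 1 else 0) = 0 then 1 else 0 := ⟨_, rfl⟩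
  have hclass := two_mul_sum_class_le hc
  rw [← hi] at hclass
  have hi1 : i ≤ 1 := hi ▸ ite_one_zero_le_one _
  obtain ⟨d, hd⟩ : ∃ d, d = if ∑ v ∈ Finset.range n, s.arr 6 v 0 <
          ∑ v ∈ Finset.range n, (if s.arr 2 v 0 = i then 1 else 0) then 1 else 0 := ⟨_, rfl⟩
  refine (((Ends.sumLoop (acc := 7) (x := 2) (N := 0) (B := n) (fun v => s.arr 2 v 0) (by decide) (by decide) (by decide) hn
    ?_).seq (Q := fun s' => (∀ b, b ≠ 1 → s'.arr b = s.arr b) ∧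
      s'.reg 8 = i ∧ s'.reg 11 = d ∧ ∀ v < n, s'.arr 1 v 0 =
        if d = 1 then s.arr 6 v 0 else if s.arr 2 v 0 = i then 1 else 0) fun s₁ ⟨a1, a2, a3⟩ => Ends.assign_seq
    ((Ends.sumLoop (acc := 9) (x := 2) (N := 0) (B := n) (fun v => if s.arr 2 v 0 = i then 1 else 0) (by decide) (by decide)
      (by decide) ?_ ?_).seq fun s₂ ⟨b1, b2, b3⟩ =>
    ((Ends.sumLoop (acc := 10) (x := 2) (N := 0) (B := n) (fun v => s.arr 6 v 0) (by decide) (by decide)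
      (by decide) ?_ ?_).seq fun s₃ ⟨c1, c2, c3⟩ => Ends.assign_seq (Ends.forLoop (x := 2) (N := 0) (B := n) (T := 18)
      (fun k s' => (∀ b, b ≠ 1 → s'.arr b = s.arr b) ∧ s'.reg 8 = i ∧ s'.reg 11 = d ∧
        ∀ v < k, s'.arr 1 v 0 = if d = 1 then s.arr 6 v 0 else if s.arr 2 v 0 = i then 1 else 0)
        (by decide) ?_ ⟨?_, ?_, ?_, ?_⟩ ?_))))).mono ?_ ?_
  · intro v _ s' k1 k2 _
    simp [Expr.eval, k1, k2]
  · simp [a2, hn]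
  · intro v _ s' k1 k2 k3
    have : s'.reg 8 = i := by
      rw [k3 8 (by decide) (by decide)]
      simp [Expr.eval, a2, a3, hn, hi]
    simp [Expr.eval, k1, k2, a1, this]
  · simp only [Expr.cost]
    omega
  · rintro s' ⟨-, -, -, h⟩
    refine ⟨i, hi1, hclass, fun v hv => ?_⟩
    rw [h v hv, hd]
    simp
  · simp [a2, b2, hn]
  · intro v _ s' k1 k2 k3
    simp [Expr.eval, k1, k2, a1, b1]
  · simp [a2, b2, c2, hn]
  · intro b _
    simp [a1, b1, c1]
  · simp [b2, c2, Expr.eval, a2, a3, hn, hi]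
  · simp [Expr.eval, b3, c2, c3, hd]
  · intro v hv
    exact absurd hv (by omega)
  · rintro v s₄ hv e2 e0 ⟨k1, k2, k3, k4⟩
    refine (Ends.put ?_).mono (by simp [Expr.cost]) fun _ h => h
    refine ⟨by simpa using e2, by simpa using e0, ?_, by simpa using k2, by simpa using k3, ?_⟩
    · intro b hb
      rw [MState.setReg_arr, MState.setArr_arr_of_ne _ hb, k1 b hb]
    · intro w hw
      simp only [Expr.eval, MState.setReg_arr, MState.setArr_arr, e2, k2, k3, k1 2 (by decide),
        k1 6 (by decide), true_and, and_true]
      rcases Nat.lt_succ_iff_lt_or_eq.1 hw with hw | rfl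
      · simpa only [hw.ne, if_false] using k4 w hw
      · rw [if_pos rfl]
        -- For `d = 0` the second summand of the output vanishes and the first is the class
        -- indicator; for `d = 1` the first vanishes and the second is the mark.
        have hd1 : d ≤ 1 := hd ▸ ite_one_zero_le_one _
        have := hf w hv
        have h01 := ite_one_zero_le_one (s.arr 2 w 0 = i)
        split_ifs <;> omega

/-! ### Graphs on `{0, …, n - 1}` and their adjacency matrices -/

section AdjArr

variable {n : ℕ} (G : SimpleGraph (Fin n))

open Classical in
theorem adjArr_fin (v w : Fin n) : adjArr G v w = if G.Adj v w then 1 else 0 := by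
  simp [adjArr]

theorem adjArr_eq_one_iff (i j : ℕ) :
    adjArr G i j = 1 ↔ ∃ (hi : i < n) (hj : j < n), G.Adj ⟨i, hi⟩ ⟨j, hj⟩ := by
  unfold adjArr
  split_ifs with h <;> simp [h]

theorem adjArr_fin_eq_one_iff (v w : Fin n) : adjArr G v w = 1 ↔ G.Adj v w := by
  rw [adjArr_eq_one_iff]
  simp

theorem adjArr_le_one (i j : ℕ) : adjArr G i j ≤ 1 := by
  unfold adjArr
  split_ifs <;> simp

theorem isCubicMatrix_adjArr (hG : ∀ v, {w | G.Adj v w}.ncard = 3) :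
    IsCubicMatrix (adjArr G) n where
  le_one := adjArr_le_one G
  symm i j := by
    have h : adjArr G i j = 1 ↔ adjArr G j i = 1 := by
      simp only [adjArr_eq_one_iff]
      exact ⟨fun ⟨hi, hj, h⟩ => ⟨hj, hi, h.symm⟩, fun ⟨hi, hj, h⟩ => ⟨hj, hi, h.symm⟩⟩
    have := adjArr_le_one G i j
    have := adjArr_le_one G j i
    omega
  diag i := by
    have h : ¬ adjArr G i i = 1 := by simp [adjArr_eq_one_iff]
    have := adjArr_le_one G i i
    omega
  sum_row i hi := by
    classical
    rw [Finset.sum_range, ← hG ⟨i, hi⟩]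
    rw [Set.ncard_eq_toFinset_card', Finset.card_eq_sum_ones, Set.toFinset_ofPred,
      Finset.sum_filter]
    exact Finset.sum_congr rfl fun w _ => adjArr_fin G ⟨i, hi⟩ w

theorem isDefectiveColoring_of_stableColoring {c : ℕ → ℕ} (hc : StableColoring (adjArr G) n c)
    (hc1 : ∀ v, c v ≤ 1) : IsDefectiveColoring G 2 1 fun v => if c v = 0 then 0 else 1 := by
  classical
  intro v
  have h : {w | G.Adj v w ∧ (if c w = 0 then (0 : Fin 2) else 1) = if c v = 0 then 0 else 1} =
      (Finset.univ.filter fun w : Fin n =>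
        adjArr G v w + (if c v = c w then 1 else 0) = 2 : Finset (Fin n)) := by
    ext w
    simp only [Finset.coe_filter, Finset.mem_univ, true_and, Set.mem_ofPred_eq, adjArr_fin]
    have := hc1 v
    have := hc1 w
    have hcc : ((if c w = 0 then (0 : Fin 2) else 1) = if c v = 0 then 0 else 1) ↔ c v = c w := by
      split_ifs <;> simp <;> omega
    rw [hcc]
    split_ifs <;> simp [*]
  have hv := hc v v.2
  rw [sameColorCount, Finset.sum_range, ← Finset.card_filter] at hv
  rw [h, Set.encard_coe_eq_coe_finsetCard]
  exact_mod_cast Nat.lt_succ_iff.1 hv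

theorem Triangle.exists_sorted {G : SimpleGraph (Fin n)} (t : Triangle G) :
    ∃ i j k, i < j ∧ j < k ∧ ∀ v, v ∈ t.1 ↔ v = i ∨ v = j ∨ v = k := by
  have hr := Finset.range_orderEmbOfFin t.1 t.card_eq
  refine ⟨t.1.orderEmbOfFin t.card_eq 0, t.1.orderEmbOfFin t.card_eq 1,
    t.1.orderEmbOfFin t.card_eq 2, by simp, by simp, fun v => ?_⟩
  rw [← Finset.mem_coe, ← hr, Set.mem_range, Fin.exists_fin_succ, Fin.exists_fin_succ,
    Fin.exists_fin_succ]
  simp [eq_comm]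

/-- The entries of the list of triangles number the vertices of the triangle graph. -/
theorem exists_triangle_numbering {L : List (ℕ × ℕ × ℕ)} (hL : L = triples (adjArr G) n n) :
    ∃ e : Fin L.length ≃ Triangle G, ∀ q v, v ∈ (e q).1 ↔
      (v : ℕ) = L[q].1 ∨ (v : ℕ) = L[q].2.1 ∨ (v : ℕ) = L[q].2.2 := by
  have hmem : ∀ t ∈ L, t.1 < n ∧ t.2.1 < n ∧ t.2.2 < n ∧ t.1 < t.2.1 ∧ t.2.1 < t.2.2 ∧
      adjArr G t.1 t.2.1 = 1 ∧ adjArr G t.2.1 t.2.2 = 1 ∧ adjArr G t.1 t.2.2 = 1 := by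
    intro t ht
    obtain ⟨h1, h2, h3, h⟩ := (mem_triples _ _).1 (hL ▸ ht)
    exact ⟨h1, h2, h3, (isTriple_iff (adjArr_le_one G) _ _ _).1 h⟩
  have hex : ∀ q : Fin L.length, ∃ t : Triangle G, ∀ v, v ∈ t.1 ↔
      (v : ℕ) = L[q].1 ∨ (v : ℕ) = L[q].2.1 ∨ (v : ℕ) = L[q].2.2 := by
    intro q
    obtain ⟨h1, h2, h3, -, -, a1, a2, a3⟩ := hmem L[q] (List.getElem_mem _)
    refine ⟨⟨{⟨_, h1⟩, ⟨_, h2⟩, ⟨_, h3⟩}, SimpleGraph.is3Clique_triple_iff.2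
      ⟨(adjArr_fin_eq_one_iff G ⟨_, h1⟩ ⟨_, h2⟩).1 a1, (adjArr_fin_eq_one_iff G ⟨_, h1⟩ ⟨_, h3⟩).1 a3,
        (adjArr_fin_eq_one_iff G ⟨_, h2⟩ ⟨_, h3⟩).1 a2⟩⟩, fun v => ?_⟩
    simp [Fin.ext_iff]
  choose f hf using hex
  refine ⟨Equiv.ofBijective f ⟨?_, ?_⟩, hf⟩
  · intro q r hqr
    -- Increasing triples with the same entries coincide, and the list has no repetitions.
    have key : ∀ x < n, (x = L[q].1 ∨ x = L[q].2.1 ∨ x = L[q].2.2) ↔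
        (x = L[r].1 ∨ x = L[r].2.1 ∨ x = L[r].2.2) := fun x hx => by
      rw [← hf q ⟨x, hx⟩, ← hf r ⟨x, hx⟩, hqr]
    obtain ⟨h1, h2, h3, h4, h5, -⟩ := hmem L[q] (List.getElem_mem _)
    obtain ⟨g1, g2, g3, g4, g5, -⟩ := hmem L[r] (List.getElem_mem _)
    have k1 := (key _ h1).1 (Or.inl rfl)
    have k2 := (key _ h2).1 (Or.inr (Or.inl rfl))
    have k3 := (key _ h3).1 (Or.inr (Or.inr rfl))
    have : L[q] = L[r] := Prod.ext (by omega) (Prod.ext (by omega) (by omega))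
    have hnd : L.Nodup := hL ▸ nodup_triples (adjArr G) n
    exact Fin.ext (hnd.getElem_inj_iff.1 this)
  · intro t
    obtain ⟨i, j, k, hij, hjk, ht⟩ := t.exists_sorted
    have hT : ((i : ℕ), (j : ℕ), (k : ℕ)) ∈ L := by
      rw [hL, mem_triples]
      refine ⟨i.2, j.2, k.2, (isTriple_iff (adjArr_le_one G) _ _ _).2 ⟨hij, hjk, ?_, ?_, ?_⟩⟩ <;>
        rw [adjArr_fin_eq_one_iff]
      · exact t.adj ((ht i).2 (by simp)) ((ht j).2 (by simp)) hij.ne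
      · exact t.adj ((ht j).2 (by simp)) ((ht k).2 (by simp)) hjk.ne
      · exact t.adj ((ht i).2 (by simp)) ((ht k).2 (by simp)) (hij.trans hjk).ne
    obtain ⟨q, hq, hLq⟩ := List.getElem_of_mem hT
    refine ⟨⟨q, hq⟩, Triangle.ext (Finset.ext fun v => ?_)⟩
    rw [hf, ht]
    simp only [Fin.getElem_fin, hLq, Fin.ext_iff]

end AdjArr

/-! ### The program for Approx1 -/

/-- The algorithm Approx1. -/
def approx1Prog : Prog :=
  .seq colorProg (.seq listProg (.seq matrixProg (.seq (.call (.var 1) 4 5)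
    (.seq markProg selectProg))))

/-- The number of steps of `approx1Prog` outside of the subroutine, for `n` vertices and `m`
triangles. -/
def approx1Time (n m : ℕ) : ℕ :=
  ((3 * n + 1) * (n * (n * 24 + 27) + 14) + 14) + (n * (n * (n * 44 + 14) + 14) + 8) +
    (m * (m * 90 + 14) + 6) + 2 + (n * (m * 38 + 23) + 6) + (n * 70 + 50)

theorem approx1Time_mono {n m m' : ℕ} (h : m ≤ m') : approx1Time n m ≤ approx1Time n m' := by
  unfold approx1Time
  gcongr

theorem exists_polynomial_approx1Time :
    ∃ p : Polynomial ℕ, ∀ n, p.eval n = approx1Time n (n ^ 3) := by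
  refine ⟨((3 * .X + 1) * (.X * (.X * 24 + 27) + 14) + 14) +
    (.X * (.X * (.X * 44 + 14) + 14) + 8) + (.X ^ 3 * (.X ^ 3 * 90 + 14) + 6) + 2 +
    (.X * (.X ^ 3 * 38 + 23) + 6) + (.X * 70 + 50), fun n => ?_⟩
  simp [approx1Time]

theorem isApprox1Output_of_select {n : ℕ} {G : SimpleGraph (Fin n)} {c f out : ℕ → ℕ} {i : ℕ}
    {I : Finset (Triangle G)} (hi : i ≤ 1) (hc : ∀ v, c v ≤ 1)
    (hclass : 2 * ∑ v ∈ Finset.range n, (if c v = i then 1 else 0) ≤ n)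
    (hf : ∀ v : Fin n, f v ≤ 1 ∧ (f v = 1 ↔ ∀ t ∈ I, v ∉ t.1))
    (hout : ∀ v < n, out v = if ∑ v ∈ Finset.range n, f v <
      ∑ v ∈ Finset.range n, (if c v = i then 1 else 0) then f v else if c v = i then 1 else 0) :
    IsApprox1Output G (fun v => if c v = 0 then 0 else 1) I
      (Finset.univ.filter fun v : Fin n => out v ≠ 0) := by
  have hmin : (Finset.univ.filter fun v : Fin n => c v = i).card =
      ∑ v ∈ Finset.range n, (if c v = i then 1 else 0) := by
    rw [Finset.card_filter, Finset.sum_range]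
  have hFI : (Finset.univ.filter fun v : Fin n => f v = 1).card = ∑ v ∈ Finset.range n, f v := by
    rw [Finset.card_filter, Finset.sum_range]
    refine Finset.sum_congr rfl fun v _ => ?_
    have := (hf v).1
    split_ifs <;> omega
  have hsum := Finset.card_filter_add_card_filter_not (s := Finset.univ)
    (fun v : Fin n => c v = i)
  rw [Finset.card_univ, Fintype.card_fin] at hsum
  refine ⟨if i = 0 then 0 else 1, Finset.univ.filter fun v : Fin n => c v = i,
    Finset.univ.filter fun v : Fin n => ¬ c v = i, Finset.univ.filter fun v : Fin n => f v = 1,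
    fun v => ?_, fun v => ?_, by omega, fun v => ?_, ?_⟩
  · have := hc v
    simp only [Finset.mem_filter, Finset.mem_univ, true_and]
    split_ifs <;> simp <;> omega
  · have := hc v
    simp only [Finset.mem_filter, Finset.mem_univ, true_and]
    split_ifs <;> simp <;> omega
  · simpa using (hf v).2
  · rw [hmin, hFI]
    by_cases h : ∑ v ∈ Finset.range n, f v < ∑ v ∈ Finset.range n, (if c v = i then 1 else 0)
    · right
      refine ⟨Finset.filter_congr fun v _ => ?_, h.le⟩
      rw [hout v v.2, if_pos h]
      have := (hf v).1
      omega
    · left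
      refine ⟨Finset.filter_congr fun v _ => ?_, not_lt.1 h⟩
      rw [hout v v.2, if_neg h]
      simp

/-- By `triangleGraph_adj_iff` the nine entries of `G` between two distinct triangles decide
adjacency, without a test for a shared edge. -/
theorem triangleMatrix_eq {n : ℕ} {G : SimpleGraph (Fin n)} {m : ℕ} (e : Fin m ≃ Triangle G)
    {l : ℕ → ℕ → ℕ} (he : ∀ (q : Fin m) (v : Fin n), v ∈ (e q).1 ↔ ∃ p < 3, l q p = v)
    (hl : ∀ (q : Fin m), ∀ p < 3, l q p < n) (i j : ℕ) :
    (if i < m ∧ j < m then triangleMatrix (adjArr G) l i j else 0) =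
      adjArr ((triangleGraph G).comap e) i j := by
  classical
  by_cases h : i < m ∧ j < m
  · obtain ⟨hi, hj⟩ := h
    rw [if_pos ⟨hi, hj⟩]
    have h01 : triangleMatrix (adjArr G) l i j ≤ 1 := ite_one_zero_le_one _
    have h01' := adjArr_le_one ((triangleGraph G).comap e) i j
    suffices h : triangleMatrix (adjArr G) l i j = 1 ↔
        adjArr ((triangleGraph G).comap e) i j = 1 by omega
    have h2 := adjArr_fin_eq_one_iff ((triangleGraph G).comap e) ⟨i, hi⟩ ⟨j, hj⟩
    simp only at h2
    rw [h2, SimpleGraph.comap_adj, triangleGraph_adj_iff, e.injective.ne_iff]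
    have h3 : (∃ u ∈ (e ⟨i, hi⟩).1, ∃ v ∈ (e ⟨j, hj⟩).1, G.Adj u v) ↔
        ¬ ∑ p ∈ Finset.range 3, ∑ q ∈ Finset.range 3, adjArr G (l i p) (l j q) = 0 := by
      simp only [Finset.sum_eq_zero_iff, Finset.mem_range, not_forall]
      constructor
      · rintro ⟨u, hu, v, hv, huv⟩
        obtain ⟨p, hp, hpu⟩ := (he _ _).1 hu
        obtain ⟨q, hq, hqv⟩ := (he _ _).1 hv
        refine ⟨p, hp, q, hq, ?_⟩
        simp only at hpu hqv
        rw [hpu, hqv, (adjArr_fin_eq_one_iff G u v).2 huv]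
        exact one_ne_zero
      · rintro ⟨p, hp, q, hq, hne⟩
        have hadj : adjArr G (l i p) (l j q) = 1 := by
          have := adjArr_le_one G (l i p) (l j q)
          omega
        exact ⟨⟨_, hl ⟨i, hi⟩ p hp⟩, (he _ _).2 ⟨p, hp, rfl⟩, ⟨_, hl ⟨j, hj⟩ q hq⟩,
          (he _ _).2 ⟨q, hq, rfl⟩, (adjArr_fin_eq_one_iff G ⟨_, hl ⟨i, hi⟩ p hp⟩
            ⟨_, hl ⟨j, hj⟩ q hq⟩).1 hadj⟩
    rw [h3]
    unfold triangleMatrix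
    by_cases hij : i = j
    · simp [hij]
    · split_ifs <;> simp_all
  · rw [if_neg h]
    have h1 : ¬ adjArr ((triangleGraph G).comap e) i j = 1 := by
      rw [adjArr_eq_one_iff]
      rintro ⟨hi, hj, -⟩
      exact h ⟨hi, hj⟩
    have := adjArr_le_one ((triangleGraph G).comap e) i j
    omega

/-- The program for Approx1 is correct, and the triangles can be numbered such that it calls its
subroutine on the triangle graph. -/
theorem exists_run_approx1Prog {n : ℕ} (G : SimpleGraph (Fin n))
    (hG : ∀ v, {w | G.Adj v w}.ncard = 3) :
    ∃ (m : ℕ) (e : Fin m ≃ Triangle G), m ≤ n ^ 3 ∧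
      ∀ (A : Prog) (J : Finset (Fin m)) (tA : ℕ),
        RunsOn noSub A ((triangleGraph G).comap e) J tA →
        ∃ (c : Fin n → Fin 2) (F : Finset (Fin n)) (t : ℕ), IsDefectiveColoring G 2 1 c ∧
          IsApprox1Output G c (J.map e.toEmbedding) F ∧ RunsOn A.asSub approx1Prog G F t ∧
          t ≤ approx1Time n (n ^ 3) + tA := by
  obtain ⟨L, hL⟩ : ∃ L, L = triples (adjArr G) n n := ⟨_, rfl⟩
  obtain ⟨e, he⟩ := exists_triangle_numbering G hL
  have hm := length_triples_le (adjArr G) n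
  have hcubic := isCubicMatrix_adjArr G hG
  have hmem : ∀ t ∈ L, t.1 < n ∧ t.2.1 < n ∧ t.2.2 < n := fun t ht => by
    rw [hL, mem_triples] at ht
    exact ⟨ht.1, ht.2.1, ht.2.2.1⟩
  rw [← hL] at hm
  -- The numbering is that of the list of triangles, fixed before `A` comes into play.
  refine ⟨_, e, hm, fun A J tA ⟨sA, hA, hJ⟩ => ?_⟩
  suffices h : Ends A.asSub approx1Prog (initState n (adjArr G)) (approx1Time n L.length + tA)
      fun s' => ∃ c : Fin n → Fin 2, IsDefectiveColoring G 2 1 c ∧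
        IsApprox1Output G c (J.map e.toEmbedding)
          (Finset.univ.filter fun v : Fin n => s'.arr 1 v 0 ≠ 0) by
    obtain ⟨s', t, h1, h2, c, hc, hF⟩ := h
    refine ⟨c, _, t, hc, hF, ⟨s', h1, fun v => by simp⟩, h2.trans ?_⟩
    have := approx1Time_mono (n := n) hm
    omega
  have init0 : (initState n (adjArr G)).reg 0 = n := rfl
  have initG : (initState n (adjArr G)).arr 0 = adjArr G := rfl
  have initA : ∀ b, b ≠ 0 → ∀ i j, (initState n (adjArr G)).arr b i j = 0 := by
    intro b hb i j
    simp [initState, hb]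
  refine ((ends_colorProg init0 hcubic fun v => initA 2 (by decide) v 0).seq
    fun s₁ ⟨a1, a2, a3, a4⟩ => (ends_listProg a2).seq fun s₂ ⟨b1, b2, b3⟩ => ?_).mono
    (T₁ := ((3 * n + 1) * (n * (n * 24 + 27) + 14) + 14) +
      ((n * (n * (n * 44 + 14) + 14) + 8) + ((L.length * (L.length * 90 + 14) + 6) +
      ((2 + tA) + ((n * (L.length * 38 + 23) + 6) + (n * 70 + 50))))))
    (by unfold approx1Time; omega) fun _ h => h
  have a0 : s₁.arr 0 = adjArr G := (a1 0 (by decide)).trans initG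
  rw [a0, ← hL] at b3
  obtain ⟨b3, b4⟩ := b3
  have b0 : s₂.arr 0 = adjArr G := (b1 0 (by decide)).trans a0
  have hentry : ∀ (q : Fin L.length),
      s₂.arr 3 q 0 = L[q].1 ∧ s₂.arr 3 q 1 = L[q].2.1 ∧ s₂.arr 3 q 2 = L[q].2.2 := fun q =>
    b4 q L[q] (by simp)
  have hlt : ∀ (q : Fin L.length), ∀ p < 3, s₂.arr 3 q p < n := by
    intro q p hp
    obtain ⟨h0, h1, h2⟩ := hentry q
    obtain ⟨k0, k1, k2⟩ := hmem L[q] (List.getElem_mem _)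
    interval_cases p <;> omega
  have hvert : ∀ (q : Fin L.length) (v : Fin n), v ∈ (e q).1 ↔ ∃ p < 3, s₂.arr 3 q p = v := by
    intro q v
    obtain ⟨h0, h1, h2⟩ := hentry q
    rw [he, ← h0, ← h1, ← h2]
    constructor
    · rintro (h | h | h)
      · exact ⟨0, by decide, h.symm⟩
      · exact ⟨1, by decide, h.symm⟩
      · exact ⟨2, by decide, h.symm⟩
    · rintro ⟨p, hp, h⟩
      interval_cases p <;> simp [h]
  refine (ends_matrixProg b3 fun i j => ?_).seq fun s₃ ⟨c1, c2, c3, c4⟩ => ?_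
  · rw [b1 4 (by decide), a1 4 (by decide), initA 4 (by decide)]
  -- Equality of whole arrays makes the given run of `A` the very run that the call performs.
  have hH : s₃.arr 4 = adjArr ((triangleGraph G).comap e) := by
    funext i j
    rw [c4, b0, triangleMatrix_eq e hvert hlt]
  refine (Ends.call (out := sA.arr 1) (t := tA) (Q := fun s₄ => s₄.reg = s₃.reg ∧
      s₄.arr = Function.update s₃.arr 5 (sA.arr 1)) ?_ ⟨rfl, rfl⟩).seq fun s₄ ⟨d1, d2⟩ => ?_
  · rw [hH, Expr.eval, c3]
    exact ⟨sA, hA, rfl⟩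
  have d0 : ∀ b, b ≠ 5 → s₄.arr b = s₃.arr b := fun b hb => by
    rw [d2, Function.update_of_ne hb]
  have d5 : s₄.arr 5 = sA.arr 1 := by rw [d2, Function.update_self]
  have d3 : s₄.arr 3 = s₂.arr 3 := (d0 3 (by decide)).trans (c1 3 (by decide))
  refine (ends_markProg (n := n) (m := L.length) ?_ ?_).seq fun s₅ ⟨f1, f2, f3⟩ => ?_
  · rw [d1, c2, b2]
  · rw [d1, c3]
  rw [d5, d3] at f3
  have e2 : s₅.arr 2 = s₁.arr 2 := by
    rw [f1 2 (by decide), d0 2 (by decide), c1 2 (by decide), b1 2 (by decide)]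
  refine (ends_selectProg f2 ?_ fun v hv => (f3 v hv).1).mono le_rfl fun s₆ ⟨i, hi, g1, g2⟩ => ?_
  · rw [e2]
    exact fun v _ => a3 v
  rw [e2] at g1 g2
  refine ⟨_, isDefectiveColoring_of_stableColoring G a4 a3,
    isApprox1Output_of_select (f := fun v => s₅.arr 6 v 0) (out := fun v => s₆.arr 1 v 0) hi a3 g1
      (fun v => ⟨(f3 v v.2).1, (f3 v v.2).2.trans ?_⟩) g2⟩
  constructor
  · intro h t ht
    obtain ⟨q, hq, rfl⟩ := Finset.mem_map.1 ht
    rw [Equiv.coe_toEmbedding, hvert]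
    rintro ⟨p, hp, hpv⟩
    exact h q q.2 ((hJ q).1 hq) p hp hpv
  · intro h q hq hq0 p hp hpv
    exact h (e ⟨q, hq⟩) (Finset.mem_map.2 ⟨⟨q, hq⟩, (hJ ⟨q, hq⟩).2 hq0, rfl⟩)
      ((hvert ⟨q, hq⟩ v).2 ⟨p, hp, hpv⟩)

/-! ### Transfer along the numbering of the triangles, and the theorem -/

theorem ncard_adj_eq_of_isRegularOfDegree {V : Type*} {G : SimpleGraph V} [G.LocallyFinite] {d : ℕ}
    (hG : G.IsRegularOfDegree d) (v : V) : {w | G.Adj v w}.ncard = d := by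
  rw [← hG v, ← SimpleGraph.card_neighborFinset_eq_degree, ← Set.ncard_coe_finset]
  congr 1
  ext w
  simp

/-- The triangle graph of a cubic graph has maximum degree at most `3`. -/
theorem degree_comap_triangleGraph_le {n m : ℕ} {G : SimpleGraph (Fin n)}
    (hG : ∀ v, {w | G.Adj v w}.ncard = 3) (e : Fin m ≃ Triangle G)
    [((triangleGraph G).comap e).LocallyFinite] (v : Fin m) :
    ((triangleGraph G).comap e).degree v ≤ 3 := by
  classical
  rw [← SimpleGraph.card_neighborFinset_eq_degree, ← Finset.card_map e.toEmbedding]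
  refine card_adj_triangleGraph_le G (fun w => ?_) (e v) _ fun s hs => ?_
  · rw [← hG w, ← Set.ncard_coe_finset]
    congr 1
    ext x
    simp
  · obtain ⟨q, hq, rfl⟩ := Finset.mem_map.1 hs
    simpa using hq

theorem isIndepSet_map_of_comap {α β : Type*} {H : SimpleGraph β} (e : α ≃ β) {J : Finset α}
    (hJ : (H.comap e).IsIndepSet (J : Set α)) :
    H.IsIndepSet (J.map e.toEmbedding : Set β) := by
  intro x hx y hy hne
  obtain ⟨a, ha, rfl⟩ := Finset.mem_map.1 (Finset.mem_coe.1 hx)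
  obtain ⟨b, hb, rfl⟩ := Finset.mem_map.1 (Finset.mem_coe.1 hy)
  exact hJ ha hb fun h => hne (by rw [h])

theorem indepNum_le_indepNum_comap {α β : Type*} [Finite α] {H : SimpleGraph β} (e : α ≃ β) :
    H.indepNum ≤ (H.comap e).indepNum := by
  have : Finite β := Finite.of_equiv _ e
  obtain ⟨I, hI⟩ := H.exists_isNIndepSet_indepNum
  rw [← hI.card_eq, ← Finset.card_map e.symm.toEmbedding]
  refine SimpleGraph.IsIndepSet.card_le_indepNum fun x hx y hy hne => ?_
  obtain ⟨a, ha, rfl⟩ := Finset.mem_map.1 (Finset.mem_coe.1 hx)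
  obtain ⟨b, hb, rfl⟩ := Finset.mem_map.1 (Finset.mem_coe.1 hy)
  simpa using hI.isIndepSet ha hb fun h => hne (by rw [h])

/-- The coefficients are natural numbers. This turns the time bound of `A` in the number of
triangles into one in `n ^ 3`. -/
theorem Polynomial.eval_mono_nat (q : Polynomial ℕ) {a b : ℕ} (h : a ≤ b) :
    q.eval a ≤ q.eval b := by
  simp only [Polynomial.eval_eq_sum, Polynomial.sum]
  gcongr

theorem theorem3 :
    (∀ (V : Type*) [Fintype V] (G : SimpleGraph V) [G.LocallyFinite], G.IsRegularOfDegree 3 →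
      ∀ ε : ℝ, 0 ≤ ε →
      ∀ c : V → Fin 2, IsDefectiveColoring G 2 1 c →
      ∀ I : Finset (Triangle G), (triangleGraph G).IsIndepSet (I : Set (Triangle G)) →
        ((triangleGraph G).indepNum : ℝ) ≤ (6 / 5 + ε) * (I.card : ℝ) →
      ∀ F : Finset V, IsApprox1Output G c I F →
        IsPathVertexCover G 4 F ∧
          (F.card : ℝ) ≤ (15 / 8 + ε) * (pathVertexCoverNum G 4 : ℝ)) ∧
    (∃ (P : Prog) (p : Polynomial ℕ), ∀ A : Prog,
      (FindsIndepSets A → ImplementsApprox1 P A p) ∧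
      ∀ ε : ℝ, 0 ≤ ε → IsMISApproximation (6 / 5 + ε) A →
        IsP4VCApproximation (15 / 8 + ε) A.asSub P) := by
  refine ⟨fun V _ G _ hG ε hε c hc I hI hα F hF =>
    isPathVertexCover_and_card_le_of_isApprox1Output G hG ε hε c hc I hI hα F hF, ?_⟩
  obtain ⟨p, hp⟩ := exists_polynomial_approx1Time
  refine ⟨approx1Prog, p, fun A => ⟨fun hA n G _ hG => ?_, fun ε hε ⟨q, hq⟩ =>
    ⟨p + q.comp (.X ^ 3), fun n G _ hG => ?_⟩⟩⟩
  · have hG' := ncard_adj_eq_of_isRegularOfDegree hG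
    obtain ⟨m, e, -, he⟩ := exists_run_approx1Prog G hG'
    let _ : ((triangleGraph G).comap e).LocallyFinite := fun v => Fintype.ofFinite _
    obtain ⟨J, tA, hrun, -⟩ := hA m ((triangleGraph G).comap e)
      (degree_comap_triangleGraph_le hG' e)
    obtain ⟨c, F, t, hc, hF, hP, ht⟩ := he A J tA hrun
    exact ⟨c, m, e, J, tA, F, t, hc, hrun, hF, hP, by rwa [hp]⟩
  · have hG' := ncard_adj_eq_of_isRegularOfDegree hG
    obtain ⟨m, e, hm, he⟩ := exists_run_approx1Prog G hG'
    let _ : ((triangleGraph G).comap e).LocallyFinite := fun v => Fintype.ofFinite _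
    obtain ⟨J, tA, hrun, htA, hJ, hα⟩ := hq m ((triangleGraph G).comap e)
      (degree_comap_triangleGraph_le hG' e)
    obtain ⟨c, F, t, hc, hF, hP, ht⟩ := he A J tA hrun
    refine ⟨F, t, hP, ?_, isPathVertexCover_and_card_le_of_isApprox1Output G hG ε hε c hc _ (isIndepSet_map_of_comap e hJ) ?_ F hF⟩
    · have := q.eval_mono_nat hm
      simp only [Polynomial.eval_add, Polynomial.eval_comp, Polynomial.eval_pow,
        Polynomial.eval_X, hp]
      omega
    · rw [Finset.card_map]
      exact le_trans (by exact_mod_cast indepNum_le_indepNum_comap e) hα
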